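/- Let $G$ be a second countable, locally compact, unimodular group with Haar measure $\mu_G$. Let $\pi : G \to \mathcal{U}(\mathcal{H}_\pi)$ be a projective unitary representation on a separable complex Hilbert space (strongly measurable, with $\pi(x)\pi(y) = \sigma(x,y)\,\pi(xy)$ for some $\sigma : G \times G \to \mathbb{T}$) that is a discrete series representation, i.e. irreducible with $\int_G |\langle h, \pi(x) h\rangle|^2 \, d\mu_G(x) < \infty$ for some $h \neq 0$. Then there is a unique $d_\pi > 0$, the formal degree of $\pi$, such that \[ \int_G \langle f_1, \pi(x) g_1\rangle \langle \pi(x) g_2, f_2\rangle \, d\mu_G(x) = d_\pi^{-1} \langle f_1, f_2\rangle \overline{\langle g_1, g_2\rangle} \qquad (f_1,f_2,g_1,g_2 \in \mathcal{H}_\pi), \] with absolutely convergent integrals. For $g \in \mathcal{H}_\pi$ write $V_g g(x) = \langle g, \pi(x) g\rangle$ and, for a relatively compact symmetric neighbourhood $Q$ of the unit $e$, $M_Q V_g g(x) = \sup_{q \in Q} |V_g g(xq)|$. Let $\mathcal{D}_\pi$ be the set of $g$ with $M_{Q} V_g g \in L^2(G)$ for some (equivalently, every) such $Q$. The system $\pi(\Lambda)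 g$, with $\Lambda \subseteq G$, is a frame with bounds $A, B > 0$ if $A\|f\|^2 \le \sum_{\lambda \in \Lambda} |\langle f, \pi(\lambda) g\rangle|^2 \le B \|f\|^2$ for all $f \in \mathcal{H}_\pi$. A strong F\o lner exhaustion sequence is a sequence $(K_n)_{n \in \mathbb{N}}$ of compact sets of positive measure such that $\mu_G(K_n K \cap K_n^c K)/\mu_G(K_n) \to 0$ for every compact $K \subseteq G$, $e \in K_n \subseteq (K_{n+1})^\circ$ for all $n$, and $\bigcup_n K_n = G$. Let $g \in \mathcal{D}_\pi$, let $Q$ be a relatively compact symmetric unit neighbourhood, and let $A, B > 0$. There is a constant $C > 0$, depending (for the given $G$, $\mu_G$ and $\pi$) only on $g$, $Q$, $A$ and $B$, such that, for every $\Lambda \subseteq G$ for which $\pi(\Lambda) g$ is a frame for $\mathcal{H}_\pi$ with bounds $A, B$ and for every strong F\o lner exhaustion sequence $(K_n)_{n\in\mathbb{N}}$ in $G$, all the numbers $\#(\Lambda \cap xK_n)$ are finite and \[ \inf_{x \in G} \#(\Lambda \cap x K_n) \ge d_\pi \big( \mu_G(K_n) - C I_n \big), \qquad n \in \mathbb{N},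 \] where \[ I_n := \int_{K_n} \int_{K_n^c Q} |M_Q V_g g(y^{-1} z)|^2 \, d\mu_G(z)\, d\mu_G(y) < \infty \qquad\text{and}\qquad I_n = o\big(\mu_G(K_n)\big) \quad (n \to \infty). \] -/

import Mathlib

open MeasureTheory Filter Asymptotics
open scoped Topology ENNReal Pointwise

/-- A projective unitary representation of `G` on `H`: a strongly measurable map into the unitary
operators that is multiplicative up to a `𝕋`-valued cocycle. -/
structure ProjectiveRep (G H : Type*) [Group G] [TopologicalSpace G] [MeasurableSpace G]
    [NormedAddCommGroup H] [InnerProductSpace ℂ H] where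
  /-- the unitary operators `π(x)` -/
  op : G → (H ≃ₗᵢ[ℂ] H)
  /-- the cocycle `σ` -/
  cocycle : G → G → Circle
  op_op : ∀ x y f, op x (op y f) = (cocycle x y : ℂ) • op (x * y) f
  stronglyMeasurable_op : ∀ f, StronglyMeasurable fun x => op x f

namespace ProjectiveRep

variable {G H : Type*} [Group G] [TopologicalSpace G] [MeasurableSpace G]
  [NormedAddCommGroup H] [InnerProductSpace ℂ H]

/-- The only closed invariant subspaces are `0` and `H`. -/
def IsIrreducible (π : ProjectiveRep G H) : Prop :=
  ∀ W : Submodule ℂ H, IsClosed (W : Set H) → (∀ x, ∀ f ∈ W, π.op x f ∈ W) → W = ⊥ ∨ W = ⊤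

/-- The coefficient transform `V_g f (x) = ⟨f, π(x) g⟩`. The inner product of the source is linear
in its first argument, whereas `inner ℂ` is linear in its second one. -/
noncomputable def coeff (π : ProjectiveRep G H) (g f : H) (x : G) : ℂ :=
  inner ℂ (π.op x g) f

/-- Irreducible, with some nonzero `g` such that `∫ |⟨g, π(x) g⟩|² dμ(x) < ∞`. -/
def IsDiscreteSeries (π : ProjectiveRep G H) (μ : Measure G) : Prop :=
  π.IsIrreducible ∧ ∃ g : H, g ≠ 0 ∧ ∫⁻ x, ‖π.coeff g g x‖ₑ ^ 2 ∂μ < ∞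

/-- `d > 0` satisfies the orthogonality relations
`∫ ⟨f₁, π(x) g₁⟩ ⟨π(x) g₂, f₂⟩ dμ(x) = d⁻¹ ⟨f₁, f₂⟩ conj ⟨g₁, g₂⟩`
(inner products linear in the first argument), the integrals being absolutely convergent. -/
def IsFormalDegree (π : ProjectiveRep G H) (μ : Measure G) (d : ℝ) : Prop :=
  0 < d ∧ ∀ f₁ f₂ g₁ g₂ : H,
    Integrable (fun x => π.coeff g₁ f₁ x * starRingEnd ℂ (π.coeff g₂ f₂ x)) μ ∧
    ∫ x, π.coeff g₁ f₁ x * starRingEnd ℂ (π.coeff g₂ f₂ x) ∂μ =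
      (d : ℂ)⁻¹ * inner ℂ f₂ f₁ * starRingEnd ℂ (inner ℂ g₂ g₁)

/-- The family `(π(λ) g)_{λ ∈ Λ}`, indexed by `Λ`, is a frame with frame bounds `A` and `B`. -/
def IsFrameWithBounds (π : ProjectiveRep G H) (Λ : Set G) (g : H) (A B : ℝ) : Prop :=
  0 < A ∧ 0 < B ∧ ∀ f : H,
    ENNReal.ofReal (A * ‖f‖ ^ 2) ≤ ∑' l : Λ, ‖π.coeff g f l‖ₑ ^ 2 ∧
    ∑' l : Λ, ‖π.coeff g f l‖ₑ ^ 2 ≤ ENNReal.ofReal (B * ‖f‖ ^ 2)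

end ProjectiveRep

/-- `Q` is a relatively compact symmetric neighbourhood of the unit. -/
def IsRelCompactSymmUnitNhd {G : Type*} [Group G] [TopologicalSpace G] (Q : Set G) : Prop :=
  Q ∈ 𝓝 (1 : G) ∧ Q⁻¹ = Q ∧ IsCompact (closure Q)

/-- The local maximal function `M_Q F (x) = sup_{z ∈ Q} |F (x z)|`, with values in `[0, ∞]`. -/
noncomputable def localMax {G : Type*} [Group G] (Q : Set G) (F : G → ℂ) (x : G) : ℝ≥0∞ :=
  ⨆ z ∈ Q, ‖F (x * z)‖ₑ

/-- The set `𝒟_π` of vectors `g` with `M_Q V_g g ∈ L²`. The condition does not depend on the choice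
of `Q`; the definition asks for it for one `Q`. -/
def ProjectiveRep.localizedVectors {G H : Type*} [Group G] [TopologicalSpace G] [MeasurableSpace G]
    [NormedAddCommGroup H] [InnerProductSpace ℂ H] (π : ProjectiveRep G H) (μ : Measure G) :
    Set H :=
  {g | ∃ Q : Set G, IsRelCompactSymmUnitNhd Q ∧ ∫⁻ x, localMax Q (π.coeff g g) x ^ 2 ∂μ < ∞}

/-- A (right) strong Følner sequence. -/
structure IsStrongFolner {G : Type*} [Group G] [TopologicalSpace G] [MeasurableSpace G]
    (μ : Measure G) (K : ℕ → Set G) : Prop where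
  isCompact : ∀ n, IsCompact (K n)
  nonnull : ∀ n, μ (K n) ≠ 0
  tendsto : ∀ L : Set G, IsCompact L →
    Tendsto (fun n => μ ((K n * L) ∩ ((K n)ᶜ * L)) / μ (K n)) atTop (𝓝 0)

/-- A strong Følner exhaustion sequence. -/
structure IsStrongFolnerExhaustion {G : Type*} [Group G] [TopologicalSpace G] [MeasurableSpace G]
    (μ : Measure G) (K : ℕ → Set G) : Prop extends IsStrongFolner μ K where
  one_mem : ∀ n, (1 : G) ∈ K n
  subset_interior : ∀ n, K n ⊆ interior (K (n + 1))
  iUnion_eq : ⋃ n, K n = Set.univ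

/-- The error term `∫_K ∫_{Kᶜ Q} |M_Q V_g g (y⁻¹ z)|² dμ(z) dμ(y)`. -/
noncomputable def ProjectiveRep.errorTerm {G H : Type*} [Group G] [TopologicalSpace G]
    [MeasurableSpace G] [NormedAddCommGroup H] [InnerProductSpace ℂ H] (π : ProjectiveRep G H)
    (μ : Measure G) (Q : Set G) (g : H) (K : Set G) : ℝ≥0∞ :=
  ∫⁻ y in K, ∫⁻ z in Kᶜ * Q, localMax Q (π.coeff g g) (y⁻¹ * z) ^ 2 ∂μ ∂μ

/-! The vectors of a dual frame of `π(Λ) g` with index in `Λ ∩ K` span a space `V` of dimension at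
most `#(Λ ∩ K)`, and the distance of `π(y) g` to `V` is controlled by the coefficients of `π(y) g`
at the points of `Λ \ K`. Integrating the decomposition of `‖π(y) g‖²` along `V` over `y ∈ K` and
bounding the part in `V` by the orthogonality relations gives
`μ(K) ‖g‖² ≤ #(Λ ∩ K) d⁻¹ ‖g‖² + A⁻¹ ∫_K ∑_{λ ∈ Λ \ K} |V_g g (y⁻¹ λ)|² dμ(y)`.
The upper frame bound makes `Λ` relatively separated, so that the last sum is at most a constant
times the integral over `Kᶜ Q` of the squared local maximal function. That this error is
`o(μ(K_n))` follows by restricting the inner integral to the boundary layer `K_n L ∩ K_nᶜ L`, for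
`L` compact; the remainder is at most `μ(K_n)` times an integral over `Lᶜ`.

The formal degree comes from Schur's lemma. Since `f ↦ V_g f` is only closed a priori, the lemma is
applied to `J J*`, where `J` is the projection of the graph of this operator to `H`; unimodularity
enters through `|V_g f (x⁻¹)| = |V_f g (x)|`, which gives the dependence on `g`.
-/

namespace ProjectiveRep

section Coefficients

variable {G H : Type*} [Group G] [TopologicalSpace G] [MeasurableSpace G]
  [NormedAddCommGroup H] [InnerProductSpace ℂ H] (π : ProjectiveRep G H)

lemma op_mul (x y : G) (f : H) :
    π.op (x * y) f = ((π.cocycle x y)⁻¹ : Circle) • π.op x (π.op y f) := by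
  rw [op_op, ← Circle.smul_def, smul_smul, inv_mul_cancel, one_smul]

lemma op_one (f : H) : π.op 1 f = π.cocycle 1 1 • f := by
  have h := π.op_op 1 1 f
  rw [one_mul, ← map_smul] at h
  exact (π.op 1).injective h

lemma symm_op (x : G) (f : H) :
    (π.op x).symm f = (π.cocycle x x⁻¹ * π.cocycle 1 1)⁻¹ • π.op x⁻¹ f := by
  rw [LinearIsometryEquiv.symm_apply_eq, Circle.smul_def, map_smul, op_op, mul_inv_cancel, op_one,
    ← Circle.smul_def, ← Circle.smul_def, smul_smul, smul_smul, mul_assoc, inv_mul_cancel, one_smul]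

lemma coeff_mul_left (g f : H) (x y : G) :
    π.coeff g f (x * y) = π.cocycle x y * π.coeff g ((π.op x).symm f) y := by
  rw [coeff, op_mul, Circle.smul_def, inner_smul_left, LinearIsometryEquiv.inner_map_eq_flip,
    ← Circle.coe_inv_eq_conj, inv_inv, coeff]

lemma norm_coeff_mul_left (g f : H) (x y : G) :
    ‖π.coeff g f (x * y)‖ = ‖π.coeff g ((π.op x).symm f) y‖ := by
  rw [coeff_mul_left, norm_mul, Circle.norm_coe, one_mul]

lemma norm_coeff_op_left (g f : H) (x y : G) :
    ‖π.coeff g (π.op x f) y‖ = ‖π.coeff g f (x⁻¹ * y)‖ := by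
  have h := π.norm_coeff_mul_left g (π.op x f) x (x⁻¹ * y)
  rwa [mul_inv_cancel_left, LinearIsometryEquiv.symm_apply_apply] at h

lemma norm_coeff_inv (g f : H) (x : G) : ‖π.coeff g f x⁻¹‖ = ‖π.coeff f g x‖ := by
  rw [coeff, ← inner_conj_symm, RCLike.norm_conj, coeff, LinearIsometryEquiv.inner_map_eq_flip,
    symm_op, Circle.smul_def, inner_smul_right, norm_mul, Circle.norm_coe, one_mul]

lemma norm_coeff_one (g f : H) : ‖π.coeff g f 1‖ = ‖inner ℂ g f‖ := by
  rw [coeff, op_one, Circle.smul_def, inner_smul_left, norm_mul, RCLike.norm_conj, Circle.norm_coe,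
    one_mul]

lemma coeff_add_right (g f f' : H) (x : G) :
    π.coeff g (f + f') x = π.coeff g f x + π.coeff g f' x := inner_add_right _ _ _

lemma coeff_smul_right (g f : H) (c : ℂ) (x : G) :
    π.coeff g (c • f) x = c * π.coeff g f x := inner_smul_right _ _ _

lemma stronglyMeasurable_coeff (g f : H) : StronglyMeasurable (π.coeff g f) :=
  (π.stronglyMeasurable_op g).inner stronglyMeasurable_const

end Coefficients

end ProjectiveRep

section Continuity

variable {G H : Type*} [Group G] [TopologicalSpace G] [IsTopologicalGroup G]
  [LocallyCompactSpace G] [SecondCountableTopology G] [MeasurableSpace G] [BorelSpace G]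

/- Steinhaus: the values of `F` lie in countably many small balls, so that one of the preimages has
positive measure. -/
lemma eventually_exists_dist_mul_lt {E : Type*} [PseudoMetricSpace E]
    {F : G → E} (hF : StronglyMeasurable F) {ε : ℝ} (hε : 0 < ε) :
    ∀ᶠ x in 𝓝 (1 : G), ∃ y, dist (F (y * x)) (F y) < ε := by
  borelize E
  let μ : Measure G := Measure.haar
  obtain ⟨s, hs, hFs⟩ := hF.isSeparable_range
  let P : E → Set G := fun e => (fun x => F x⁻¹) ⁻¹' Metric.ball e (ε / 2)
  have hcover : ⋃ e ∈ s, P e = Set.univ := by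
    refine Set.eq_univ_of_forall fun x => Set.mem_iUnion₂.2 ?_
    obtain ⟨e, he, hxe⟩ := Metric.mem_closure_iff.1 (hFs ⟨x⁻¹, rfl⟩) (ε / 2) (half_pos hε)
    exact ⟨e, he, hxe⟩
  obtain ⟨e, he⟩ : ∃ e, 0 < μ (P e) := by
    by_contra! hnull
    refine NeZero.ne μ (Measure.measure_univ_eq_zero.1 (hcover ▸ ?_))
    exact (measure_biUnion_null_iff hs).2 fun e _ => nonpos_iff_eq_zero.1 (hnull e)
  have hP : MeasurableSet (P e) :=
    (hF.measurable.comp measurable_inv) Metric.isOpen_ball.measurableSet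
  filter_upwards [Measure.div_mem_nhds_one_of_haar_pos μ (P e) hP he] with x hx
  obtain ⟨a, ha, b, hb, rfl⟩ := Set.mem_div.1 hx
  refine ⟨a⁻¹, ?_⟩
  rw [div_eq_mul_inv, inv_mul_cancel_left]
  linarith [dist_triangle_right (F b⁻¹) (F a⁻¹) e, Metric.mem_ball.1 ha, Metric.mem_ball.1 hb]

namespace ProjectiveRep

variable {H : Type*} [NormedAddCommGroup H] [InnerProductSpace ℂ H] (π : ProjectiveRep G H)

lemma eventually_exists_norm_smul_op_sub_lt (f : H) {ε : ℝ} (hε : 0 < ε) :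
    ∀ᶠ x in 𝓝 (1 : G), ∃ c : Circle, ‖c • π.op x f - f‖ < ε := by
  filter_upwards [eventually_exists_dist_mul_lt (π.stronglyMeasurable_op f) hε] with x ⟨y, hy⟩
  refine ⟨(π.cocycle y x)⁻¹, ?_⟩
  rwa [op_mul, Circle.smul_def, ← map_smul, LinearIsometryEquiv.dist_map, dist_eq_norm] at hy

lemma continuousAt_norm_coeff_one (g f : H) : ContinuousAt (fun x => ‖π.coeff g f x‖) 1 := by
  rw [ContinuousAt, Metric.tendsto_nhds]
  intro ε hε
  filter_upwards [π.eventually_exists_norm_smul_op_sub_lt g (ε := ε / (‖f‖ + 1)) (by positivity)]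
    with x ⟨c, hc⟩
  have hcoeff : ‖π.coeff g f x‖ = ‖inner ℂ (c • π.op x g) f‖ := by
    rw [Circle.smul_def, inner_smul_left, norm_mul, RCLike.norm_conj, Circle.norm_coe, one_mul,
      coeff]
  calc |‖π.coeff g f x‖ - ‖π.coeff g f 1‖|
      = |‖inner ℂ (c • π.op x g) f‖ - ‖inner ℂ g f‖| := by rw [hcoeff, norm_coeff_one]
    _ ≤ ‖inner ℂ (c • π.op x g - g) f‖ := by
        rw [inner_sub_left]; exact abs_norm_sub_norm_le _ _
    _ ≤ ‖c • π.op x g - g‖ * ‖f‖ := norm_inner_le_norm _ _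
    _ ≤ ε / (‖f‖ + 1) * ‖f‖ := by gcongr
    _ < ε / (‖f‖ + 1) * (‖f‖ + 1) := by gcongr; linarith
    _ = ε := by field_simp

lemma continuous_norm_coeff (g f : H) : Continuous fun x => ‖π.coeff g f x‖ := by
  refine continuous_iff_continuousAt.2 fun x => ?_
  have htranslate : (fun y => ‖π.coeff g f y‖) =
      (fun z => ‖π.coeff g ((π.op x).symm f) z‖) ∘ fun y => x⁻¹ * y := by
    funext y
    rw [Function.comp_apply, ← norm_coeff_mul_left, mul_inv_cancel_left]
  rw [htranslate]
  refine ContinuousAt.comp ?_ (continuous_const_mul x⁻¹).continuousAt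
  rw [inv_mul_cancel]
  exact π.continuousAt_norm_coeff_one g _

lemma continuous_enorm_coeff (g f : H) : Continuous fun x => ‖π.coeff g f x‖ₑ := by
  simpa only [Function.comp_def, ofReal_norm] using
    ENNReal.continuous_ofReal.comp (π.continuous_norm_coeff g f)

end ProjectiveRep

end Continuity

section Unimodular

/- Inversion multiplies `μ` by a constant, which is `1` since there is a symmetric compact set of
positive measure. -/
lemma isInvInvariant_of_isMulRightInvariant {G : Type*} [Group G] [TopologicalSpace G]
    [IsTopologicalGroup G] [LocallyCompactSpace G] [SecondCountableTopology G] [MeasurableSpace G]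
    [BorelSpace G] (μ : Measure G) [μ.IsHaarMeasure] [μ.IsMulRightInvariant] :
    μ.IsInvInvariant := by
  have : μ.inv.IsHaarMeasure :=
    { toIsFiniteMeasureOnCompacts := inferInstance
      toIsMulLeftInvariant := inferInstance
      toIsOpenPosMeasure := (Homeomorph.inv G).continuous.isOpenPosMeasure_map
        (Homeomorph.inv G).surjective }
  obtain ⟨K, hK, hK1⟩ := exists_compact_mem_nhds (1 : G)
  let S := K ∪ K⁻¹
  have hS0 : μ S ≠ 0 :=
    (Measure.measure_pos_of_mem_nhds μ (mem_of_superset hK1 Set.subset_union_left)).ne'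
  have hSfin : μ S ≠ ∞ := (hK.union hK.inv).measure_ne_top
  have hscale : μ.inv = Measure.haarScalarFactor μ.inv μ • μ :=
    Measure.isMulLeftInvariant_eq_smul μ.inv μ
  have hone : Measure.haarScalarFactor μ.inv μ = 1 := by
    have h : μ.inv S = Measure.haarScalarFactor μ.inv μ • μ S := by
      conv_lhs => rw [hscale]
      rfl
    rw [Measure.inv_apply, Set.union_inv, inv_inv, Set.union_comm, ENNReal.smul_def, smul_eq_mul]
      at h
    exact_mod_cast (ENNReal.mul_left_inj hS0 hSfin).1 ((one_mul _).trans h).symm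
  exact ⟨by rw [hscale, hone, one_smul]⟩

end Unimodular

section Schur

lemma subsingleton_spectrum_of_cfc_mul_eq_zero {A : Type*} [TopologicalSpace A] [Ring A]
    [StarRing A] [Algebra ℝ A] [ContinuousFunctionalCalculus ℝ A IsSelfAdjoint] {a : A}
    (ha : IsSelfAdjoint a)
    (h : ∀ φ ψ : ℝ → ℝ, cfc φ a * cfc ψ a = 0 → cfc φ a = 0 ∨ cfc ψ a = 0) :
    (spectrum ℝ a).Subsingleton := by
  intro s hs t ht
  by_contra hst
  wlog hlt : s < t generalizing s t
  · exact this ht hs (Ne.symm hst) (lt_of_le_of_ne (not_lt.1 hlt) (Ne.symm hst))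
  let φ : ℝ → ℝ := fun x => max ((s + t) / 2 - x) 0
  let ψ : ℝ → ℝ := fun x => max (x - (s + t) / 2) 0
  have hφ : Continuous φ := by fun_prop
  have hψ : Continuous ψ := by fun_prop
  have hφψ : φ * ψ = 0 := by
    funext x
    rcases le_total x ((s + t) / 2) with hx | hx <;> simp [φ, ψ, hx]
  have hmul : cfc φ a * cfc ψ a = 0 := by
    rw [← cfc_mul φ ψ a hφ.continuousOn hψ.continuousOn]
    exact (congrArg (cfc · a) hφψ).trans (cfc_zero ℝ a)
  rcases h φ ψ hmul with h0 | h0 <;> rw [← cfc_zero ℝ a] at h0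
  · have hs0 : φ s = 0 := eqOn_of_cfc_eq_cfc h0 hφ.continuousOn continuousOn_const ha hs
    simp only [φ, max_eq_right_iff] at hs0
    linarith
  · have ht0 : ψ t = 0 := eqOn_of_cfc_eq_cfc h0 hψ.continuousOn continuousOn_const ha ht
    simp only [ψ, max_eq_right_iff] at ht0
    linarith

namespace ProjectiveRep

variable {G H : Type*} [Group G] [TopologicalSpace G] [MeasurableSpace G]
  [NormedAddCommGroup H] [InnerProductSpace ℂ H] {π : ProjectiveRep G H}

lemma IsIrreducible.eq_zero_or_injective_of_commute (hπ : π.IsIrreducible) {T : H →L[ℂ] H}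
    (hT : ∀ x f, T (π.op x f) = π.op x (T f)) : T = 0 ∨ Function.Injective T := by
  rcases hπ (LinearMap.ker T.toLinearMap) T.isClosed_ker
    (fun x f (hf : T f = 0) => show T (π.op x f) = 0 by rw [hT, hf, map_zero]) with hker | hker
  · exact .inr (LinearMap.ker_eq_bot.1 hker)
  · exact .inl (ContinuousLinearMap.coe_injective (LinearMap.ker_eq_top.1 hker))

lemma IsIrreducible.exists_eq_smul_of_commute [CompleteSpace H] (hπ : π.IsIrreducible)
    {T : H →L[ℂ] H} (hT : IsSelfAdjoint T) (hcomm : ∀ x f, T (π.op x f) = π.op x (T f)) :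
    ∃ r : ℝ, ∀ f, T f = r • f := by
  have hcfc (φ : ℝ → ℝ) (x : G) (f : H) : cfc φ T (π.op x f) = π.op x (cfc φ T f) := by
    have h : Commute T ((π.op x).toContinuousLinearEquiv : H →L[ℂ] H) :=
      ContinuousLinearMap.ext (hcomm x)
    exact DFunLike.congr_fun (h.cfc_real φ).eq f
  have hspec : (spectrum ℝ T).Subsingleton := by
    refine subsingleton_spectrum_of_cfc_mul_eq_zero hT fun φ ψ hmul => ?_
    refine (hπ.eq_zero_or_injective_of_commute (hcfc φ)).imp_right fun hinj => ?_
    ext f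
    exact hinj ((DFunLike.congr_fun hmul f).trans (map_zero _).symm)
  obtain ⟨r, hr⟩ : ∃ r, spectrum ℝ T ⊆ {r} :=
    hspec.eq_empty_or_singleton.elim (fun h => ⟨0, by simp [h]⟩) fun ⟨r, h⟩ => ⟨r, h.subset⟩
  refine ⟨r, fun f => ?_⟩
  conv_lhs => rw [CFC.eq_algebraMap_of_spectrum_subset_singleton T r hr hT]
  simp only [Algebra.algebraMap_eq_smul_one, smul_apply, one_apply_eq_self]

end ProjectiveRep

end Schur

section OrthogonalityInFirstVariable

namespace ProjectiveRep

variable {G H : Type*} [Group G] [TopologicalSpace G] [MeasurableSpace G]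
  [NormedAddCommGroup H] [InnerProductSpace ℂ H] (π : ProjectiveRep G H) (μ : Measure G)

/-- The graph of the coefficient transform `f ↦ V_g f`, seen as an unbounded operator from `H` to
`L²` with domain `{f | V_g f ∈ L²}`. -/
noncomputable def coeffGraph (g : H) : Submodule ℂ (WithLp 2 (H × Lp ℂ 2 μ)) where
  carrier := {p | p.snd =ᵐ[μ] π.coeff g p.fst}
  add_mem' := by
    intro p q hp hq
    filter_upwards [hp, hq, Lp.coeFn_add p.snd q.snd] with x hpx hqx hx
    rw [WithLp.add_snd, hx, Pi.add_apply, hpx, hqx, WithLp.add_fst, coeff_add_right]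
  zero_mem' := by
    filter_upwards [Lp.coeFn_zero ℂ 2 μ] with x hx
    exact hx.trans (inner_zero_right _).symm
  smul_mem' := by
    intro c p hp
    filter_upwards [hp, Lp.coeFn_smul c p.snd] with x hpx hx
    rw [WithLp.smul_snd, hx, Pi.smul_apply, hpx, WithLp.smul_fst, coeff_smul_right, smul_eq_mul]

/-- The projection of the graph of `f ↦ V_g f` to the domain. Its adjoint replaces the adjoint of
the unbounded operator `f ↦ V_g f`. -/
noncomputable def coeffGraphFst (g : H) : π.coeffGraph μ g →L[ℂ] H :=
  (WithLp.fstL 2 ℂ H (Lp ℂ 2 μ)).comp (π.coeffGraph μ g).subtypeL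

variable {π μ} in
lemma coeffGraph_snd_ae_eq {g : H} (v : π.coeffGraph μ g) :
    v.1.snd =ᵐ[μ] π.coeff g (π.coeffGraphFst μ g v) := v.2

lemma isClosed_coeffGraph (g : H) :
    IsClosed (π.coeffGraph μ g : Set (WithLp 2 (H × Lp ℂ 2 μ))) := by
  refine IsSeqClosed.isClosed fun p q hp hpq => ?_
  have hfst : Tendsto (fun n => (p n).fst) atTop (𝓝 q.fst) :=
    ((WithLp.fstL 2 ℂ H (Lp ℂ 2 μ)).continuous.tendsto q).comp hpq
  have hsnd : Tendsto (fun n => (p n).snd) atTop (𝓝 q.snd) :=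
    ((WithLp.sndL 2 ℂ H (Lp ℂ 2 μ)).continuous.tendsto q).comp hpq
  obtain ⟨φ, hφ, hae⟩ := (tendstoInMeasure_of_tendsto_Lp hsnd).exists_seq_tendsto_ae
  have hgraph : ∀ᵐ x ∂μ, ∀ n, (p n).snd x = π.coeff g (p n).fst x := ae_all_iff.2 hp
  change q.snd =ᵐ[μ] π.coeff g q.fst
  filter_upwards [hae, hgraph] with x hx hpx
  simp_rw [hpx] at hx
  exact tendsto_nhds_unique hx ((tendsto_const_nhds.inner hfst).comp hφ.tendsto_atTop)

instance [CompleteSpace H] (g : H) : CompleteSpace (π.coeffGraph μ g) :=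
  (π.isClosed_coeffGraph μ g).completeSpace_coe

variable {π μ}

lemma injective_coeffGraphFst (g : H) : Function.Injective (π.coeffGraphFst μ g) := by
  intro v w h
  refine Subtype.ext (WithLp.ofLp_injective 2 (Prod.ext h (Lp.ext ?_)))
  exact (coeffGraph_snd_ae_eq v).trans (h ▸ (coeffGraph_snd_ae_eq w).symm)

lemma memLp_coeff_coeffGraphFst {g : H} (v : π.coeffGraph μ g) :
    MemLp (π.coeff g (π.coeffGraphFst μ g v)) 2 μ :=
  (memLp_congr_ae (coeffGraph_snd_ae_eq v)).1 (Lp.memLp v.1.snd)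

lemma exists_coeffGraphFst_eq {g f : H} (hf : MemLp (π.coeff g f) 2 μ) :
    ∃ v, π.coeffGraphFst μ g v = f :=
  ⟨⟨WithLp.toLp 2 (f, hf.toLp _), hf.coeFn_toLp⟩, rfl⟩

lemma inner_coeffGraph {g f f' : H} {v w : π.coeffGraph μ g} (hv : π.coeffGraphFst μ g v = f)
    (hw : π.coeffGraphFst μ g w = f') :
    inner ℂ v w =
      inner ℂ f f' + ∫ x, π.coeff g f' x * starRingEnd ℂ (π.coeff g f x) ∂μ := by
  subst hv hw
  rw [Submodule.coe_inner, WithLp.prod_inner_apply, L2.inner_def]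
  congr 1
  refine integral_congr_ae ?_
  filter_upwards [coeffGraph_snd_ae_eq v, coeffGraph_snd_ae_eq w] with x hv hw
  rw [WithLp.snd] at hv hw
  rw [RCLike.inner_apply, hv, hw]

variable [IsTopologicalGroup G] [BorelSpace G] [μ.IsMulLeftInvariant]

lemma memLp_coeff_op {g f : H} (hf : MemLp (π.coeff g f) 2 μ) (y : G) :
    MemLp (π.coeff g (π.op y f)) 2 μ :=
  (hf.comp_measurePreserving (measurePreserving_mul_left μ y⁻¹)).congr_norm
    (π.stronglyMeasurable_coeff _ _).aestronglyMeasurable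
    (Eventually.of_forall fun x => (π.norm_coeff_op_left g f y x).symm)

lemma memLp_coeff_symm_op {g f : H} (hf : MemLp (π.coeff g f) 2 μ) (y : G) :
    MemLp (π.coeff g ((π.op y).symm f)) 2 μ :=
  (hf.comp_measurePreserving (measurePreserving_mul_left μ y)).congr_norm
    (π.stronglyMeasurable_coeff _ _).aestronglyMeasurable
    (Eventually.of_forall fun x => π.norm_coeff_mul_left g f y x)

lemma integral_coeff_op_mul_conj (g f f' : H) (y : G) :
    ∫ x, π.coeff g (π.op y f) x * starRingEnd ℂ (π.coeff g f' x) ∂μ =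
      ∫ x, π.coeff g f x * starRingEnd ℂ (π.coeff g ((π.op y).symm f') x) ∂μ := by
  rw [← integral_mul_left_eq_self _ y]
  refine integral_congr_ae (Eventually.of_forall fun x => ?_)
  simp only [coeff_mul_left, LinearIsometryEquiv.symm_apply_apply, map_mul]
  rw [mul_mul_mul_comm, RCLike.mul_conj, Circle.norm_coe, RCLike.ofReal_one, one_pow, one_mul]

variable [CompleteSpace H]

lemma coeffGraphFst_adjoint_op (g h : H) (y : G) :
    π.coeffGraphFst μ g ((π.coeffGraphFst μ g).adjoint (π.op y h)) =
      π.op y (π.coeffGraphFst μ g ((π.coeffGraphFst μ g).adjoint h)) := by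
  set J := π.coeffGraphFst μ g
  obtain ⟨u, hu⟩ := exists_coeffGraphFst_eq
    (memLp_coeff_op (memLp_coeff_coeffGraphFst (J.adjoint h)) y)
  suffices J.adjoint (π.op y h) = u by rw [this, hu]
  refine ext_inner_left ℂ fun v => ?_
  obtain ⟨w, hw⟩ := exists_coeffGraphFst_eq
    (memLp_coeff_symm_op (memLp_coeff_coeffGraphFst v) y)
  calc inner ℂ v (J.adjoint (π.op y h))
      = inner ℂ (J v) (π.op y h) := ContinuousLinearMap.adjoint_inner_right J v _
    _ = inner ℂ (J w) h := by
        rw [hw, (π.op y).symm.inner_map_eq_flip, LinearIsometryEquiv.symm_symm]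
    _ = inner ℂ w (J.adjoint h) := (ContinuousLinearMap.adjoint_inner_right J w h).symm
    _ = inner ℂ ((π.op y).symm (J v)) (J (J.adjoint h)) +
          ∫ x, π.coeff g (J (J.adjoint h)) x *
            starRingEnd ℂ (π.coeff g ((π.op y).symm (J v)) x) ∂μ := inner_coeffGraph hw rfl
    _ = inner ℂ (J v) (π.op y (J (J.adjoint h))) +
          ∫ x, π.coeff g (π.op y (J (J.adjoint h))) x * starRingEnd ℂ (π.coeff g (J v) x) ∂μ :=
        congrArg₂ (· + ·) ((π.op y).symm.inner_map_eq_flip _ _)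
          (integral_coeff_op_mul_conj _ _ _ y).symm
    _ = inner ℂ v u := (inner_coeffGraph rfl hu).symm

lemma IsIrreducible.exists_coeffGraphFst_adjoint_eq_smul (hπ : π.IsIrreducible) {g f₀ : H}
    (hf₀ : f₀ ≠ 0) (hL : MemLp (π.coeff g f₀) 2 μ) :
    ∃ r : ℝ, r ≠ 0 ∧
      ∀ f, π.coeffGraphFst μ g ((π.coeffGraphFst μ g).adjoint f) = r • f := by
  set J := π.coeffGraphFst μ g
  obtain ⟨r, hr⟩ := hπ.exists_eq_smul_of_commute (T := J.comp J.adjoint)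
    (by rw [ContinuousLinearMap.isSelfAdjoint_iff', ContinuousLinearMap.adjoint_comp,
      ContinuousLinearMap.adjoint_adjoint]) fun y h => coeffGraphFst_adjoint_op g h y
  refine ⟨r, ?_, hr⟩
  rintro rfl
  have hadj : J.adjoint f₀ = 0 :=
    injective_coeffGraphFst g ((hr f₀).trans (by rw [zero_smul, map_zero]))
  obtain ⟨v, hv : J v = f₀⟩ := exists_coeffGraphFst_eq hL
  have hinner := ContinuousLinearMap.adjoint_inner_right J v f₀
  rw [hadj, inner_zero_right, hv] at hinner
  exact hf₀ (inner_self_eq_zero.1 hinner.symm)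

lemma IsIrreducible.exists_integral_coeff_eq (hπ : π.IsIrreducible) {g f₀ : H} (hf₀ : f₀ ≠ 0)
    (hL : MemLp (π.coeff g f₀) 2 μ) :
    ∃ C : ℝ, ∀ f, MemLp (π.coeff g f) 2 μ ∧ ∀ f',
      ∫ x, π.coeff g f x * starRingEnd ℂ (π.coeff g f' x) ∂μ = C * inner ℂ f' f := by
  obtain ⟨r, hr0, hr⟩ := hπ.exists_coeffGraphFst_adjoint_eq_smul hf₀ hL
  set J := π.coeffGraphFst μ g
  have hJ (f : H) : J (J.adjoint (r⁻¹ • f)) = f := by rw [hr, smul_inv_smul₀ hr0]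
  refine ⟨r⁻¹ - 1, fun f => ⟨hJ f ▸ memLp_coeff_coeffGraphFst _, fun f' => ?_⟩⟩
  have hinner := ContinuousLinearMap.adjoint_inner_right J (J.adjoint (r⁻¹ • f')) (r⁻¹ • f)
  rw [inner_coeffGraph (hJ f') (hJ f), hJ, ← Complex.coe_smul, inner_smul_right] at hinner
  push_cast at hinner ⊢
  linear_combination hinner

end ProjectiveRep

end OrthogonalityInFirstVariable

section FormalDegree

lemma sesqForm_ext_diag {E : Type*} [AddCommGroup E] [Module ℂ E]
    {B B' : E →ₗ⋆[ℂ] E →ₗ[ℂ] ℂ} (h : ∀ x, B x x = B' x x) : B = B' := by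
  ext x y
  have hadd := h (x + y)
  have haddI := h (x + Complex.I • y)
  simp only [map_add, map_smul, map_smulₛₗ, LinearMap.add_apply, LinearMap.smul_apply, smul_eq_mul,
    h x, h y, Complex.conj_I] at hadd haddI
  linear_combination (1 / 2 : ℂ) * hadd - (Complex.I / 2) * haddI +
    (1 / 2) * (B x y - B y x - B' x y + B' y x) * Complex.I_mul_I

namespace ProjectiveRep

variable {G H : Type*} [Group G] [TopologicalSpace G] [MeasurableSpace G]
  [NormedAddCommGroup H] [InnerProductSpace ℂ H] {π : ProjectiveRep G H} {μ : Measure G}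

lemma integrable_coeff_mul_conj {g₁ g₂ f₁ f₂ : H} (h₁ : MemLp (π.coeff g₁ f₁) 2 μ)
    (h₂ : MemLp (π.coeff g₂ f₂) 2 μ) :
    Integrable (fun x => π.coeff g₁ f₁ x * starRingEnd ℂ (π.coeff g₂ f₂ x)) μ :=
  h₁.integrable_mul h₂.star

lemma integral_coeff_mul_conj_of_diag {f₁ f₂ : H} (h₁ : ∀ g, MemLp (π.coeff g f₁) 2 μ)
    (h₂ : ∀ g, MemLp (π.coeff g f₂) 2 μ) {c : ℂ}
    (hdiag : ∀ g, ∫ x, π.coeff g f₁ x * starRingEnd ℂ (π.coeff g f₂ x) ∂μ = c * inner ℂ g g)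
    (g₁ g₂ : H) :
    ∫ x, π.coeff g₁ f₁ x * starRingEnd ℂ (π.coeff g₂ f₂ x) ∂μ = c * inner ℂ g₁ g₂ := by
  have hint (g g') := integrable_coeff_mul_conj (h₁ g) (h₂ g')
  let B : H →ₗ⋆[ℂ] H →ₗ[ℂ] ℂ := LinearMap.mk₂'ₛₗ (starRingEnd ℂ) (RingHom.id ℂ)
    (fun g g' => ∫ x, π.coeff g f₁ x * starRingEnd ℂ (π.coeff g' f₂ x) ∂μ)
    (fun x y z => by
      rw [← integral_add (hint _ _) (hint _ _)]
      simp only [coeff, map_add, inner_add_left, add_mul])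
    (fun c x y => by
      rw [smul_eq_mul, ← integral_const_mul]
      simp only [coeff, map_smul, inner_smul_left, mul_assoc])
    (fun x y z => by
      rw [← integral_add (hint _ _) (hint _ _)]
      simp only [coeff, map_add, inner_add_left, mul_add])
    (fun c x y => by
      rw [RingHom.id_apply, smul_eq_mul, ← integral_const_mul]
      simp only [coeff, map_smul, inner_smul_left, map_mul, RCLike.conj_conj, mul_left_comm])
  have hB : B = c • innerₛₗ ℂ := sesqForm_ext_diag hdiag
  exact DFunLike.congr_fun (DFunLike.congr_fun hB g₁) g₂

lemma IsFormalDegree.lintegral_enorm_coeff_sq {d : ℝ} (hd : π.IsFormalDegree μ d) (g f : H) :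
    ∫⁻ x, ‖π.coeff g f x‖ₑ ^ 2 ∂μ = ENNReal.ofReal (d⁻¹ * ‖f‖ ^ 2 * ‖g‖ ^ 2) := by
  obtain ⟨hint, heq⟩ := hd.2 f f g g
  simp_rw [Complex.mul_conj', ← Complex.ofReal_pow] at hint heq
  rw [integral_complex_ofReal, inner_self_eq_norm_sq_to_K, inner_self_eq_norm_sq_to_K] at heq
  simp only [Complex.coe_algebraMap, map_pow, Complex.conj_ofReal] at heq
  norm_cast at heq
  rw [← heq, ofReal_integral_eq_lintegral_ofReal
    (by simpa only [RCLike.re_to_complex, Complex.ofReal_re] using hint.re)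
    (Eventually.of_forall fun x => by positivity)]
  simp_rw [ENNReal.ofReal_pow (norm_nonneg _), ofReal_norm]

lemma IsFormalDegree.unique [Nontrivial H] {d d' : ℝ} (hd : π.IsFormalDegree μ d)
    (hd' : π.IsFormalDegree μ d') : d = d' := by
  obtain ⟨g, hg⟩ := exists_ne (0 : H)
  have hg' : ‖g‖ ≠ 0 := norm_ne_zero_iff.2 hg
  have hpos := hd.1
  have hpos' := hd'.1
  have heq := hd.lintegral_enorm_coeff_sq g g
  rw [hd'.lintegral_enorm_coeff_sq g g, ENNReal.ofReal_eq_ofReal_iff (by positivity)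
    (by positivity)] at heq
  field_simp at heq
  exact heq

lemma IsDiscreteSeries.nontrivial (hπ : π.IsDiscreteSeries μ) : Nontrivial H := by
  obtain ⟨-, g, hg, -⟩ := hπ
  exact ⟨g, 0, hg⟩

variable [IsTopologicalGroup G] [BorelSpace G]

lemma memLp_coeff_swap [μ.IsInvInvariant] {g f : H} (h : MemLp (π.coeff g f) 2 μ) :
    MemLp (π.coeff f g) 2 μ :=
  (h.comp_measurePreserving (Measure.measurePreserving_inv μ)).congr_norm
    (π.stronglyMeasurable_coeff _ _).aestronglyMeasurable
    (Eventually.of_forall fun x => π.norm_coeff_inv g f x)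

lemma integral_coeff_mul_conj_swap [μ.IsInvInvariant] (g f : H) :
    ∫ x, π.coeff g f x * starRingEnd ℂ (π.coeff g f x) ∂μ =
      ∫ x, π.coeff f g x * starRingEnd ℂ (π.coeff f g x) ∂μ := by
  rw [← integral_inv_eq_self]
  simp_rw [Complex.mul_conj', norm_coeff_inv]

variable [LocallyCompactSpace G] [SecondCountableTopology G]

lemma integral_norm_coeff_self_sq_pos [μ.IsOpenPosMeasure] {g : H} (hg : g ≠ 0)
    (h : MemLp (π.coeff g g) 2 μ) : 0 < ∫ x, ‖π.coeff g g x‖ ^ 2 ∂μ := by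
  rw [integral_pos_iff_support_of_nonneg (fun x => by positivity)
    ((memLp_two_iff_integrable_sq_norm h.1).1 h)]
  refine ((π.continuous_norm_coeff g g).pow 2).isOpen_support.measure_pos μ ⟨1, ?_⟩
  rw [Function.mem_support, Pi.pow_apply, norm_coeff_one]
  exact pow_ne_zero 2 (norm_ne_zero_iff.2 (inner_self_ne_zero.2 hg))

variable [CompleteSpace H] [μ.IsHaarMeasure] [μ.IsInvInvariant]

/- The constants `C g` with `‖V_g f‖² = C g * ‖f‖²` are proportional to `‖g‖²`, since
`‖V_g f‖ = ‖V_f g‖` by unimodularity. -/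
lemma IsDiscreteSeries.exists_integral_coeff_eq (hπ : π.IsDiscreteSeries μ) :
    ∃ k : ℝ, 0 < k ∧ ∀ g f, MemLp (π.coeff g f) 2 μ ∧ ∀ f',
      ∫ x, π.coeff g f x * starRingEnd ℂ (π.coeff g f' x) ∂μ =
        k * inner ℂ g g * inner ℂ f' f := by
  obtain ⟨hirr, g₀, hg₀, hfin⟩ := hπ
  have hmem₀ : MemLp (π.coeff g₀ g₀) 2 μ := by
    refine ⟨(π.stronglyMeasurable_coeff g₀ g₀).aestronglyMeasurable, ?_⟩
    rw [eLpNorm_lt_top_iff_lintegral_rpow_enorm_lt_top two_ne_zero ENNReal.ofNat_ne_top]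
    simpa using hfin
  obtain ⟨C₀, hC₀⟩ := hirr.exists_integral_coeff_eq hg₀ hmem₀
  choose C hC using fun g =>
    hirr.exists_integral_coeff_eq hg₀ (memLp_coeff_swap (hC₀ g).1)
  have : 0 < ‖g₀‖ := norm_pos_iff.2 hg₀
  have hself (f : H) : inner ℂ f f = ((‖f‖ ^ 2 : ℝ) : ℂ) := by
    rw [inner_self_eq_norm_sq_to_K, Complex.ofReal_pow]
    rfl
  have hCswap (g : H) : C g * ‖g₀‖ ^ 2 = C g₀ * ‖g‖ ^ 2 := by
    have h := integral_coeff_mul_conj_swap (π := π) (μ := μ) g g₀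
    rw [(hC g g₀).2 g₀, (hC g₀ g).2 g, hself, hself] at h
    exact_mod_cast h
  have hCpos : 0 < C g₀ := by
    have h := (hC g₀ g₀).2 g₀
    simp_rw [Complex.mul_conj', ← Complex.ofReal_pow] at h
    rw [integral_complex_ofReal, hself] at h
    have h' : ∫ x, ‖π.coeff g₀ g₀ x‖ ^ 2 ∂μ = C g₀ * ‖g₀‖ ^ 2 := by exact_mod_cast h
    exact pos_of_mul_pos_left (h' ▸ integral_norm_coeff_self_sq_pos hg₀ hmem₀) (by positivity)
  refine ⟨C g₀ / ‖g₀‖ ^ 2, by positivity, fun g f => ⟨(hC g f).1, fun f' => ?_⟩⟩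
  have hCg : C g = C g₀ / ‖g₀‖ ^ 2 * ‖g‖ ^ 2 := by
    rw [div_mul_eq_mul_div, ← hCswap, mul_div_cancel_right₀ _ (by positivity)]
  rw [(hC g f).2 f', hCg, hself g, Complex.ofReal_mul]

lemma IsDiscreteSeries.exists_isFormalDegree (hπ : π.IsDiscreteSeries μ) :
    ∃ d : ℝ, π.IsFormalDegree μ d := by
  obtain ⟨k, hk, h⟩ := hπ.exists_integral_coeff_eq
  refine ⟨k⁻¹, inv_pos.2 hk, fun f₁ f₂ g₁ g₂ =>
    ⟨integrable_coeff_mul_conj (h g₁ f₁).1 (h g₂ f₂).1, ?_⟩⟩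
  rw [inner_conj_symm, Complex.ofReal_inv, inv_inv]
  refine integral_coeff_mul_conj_of_diag (fun g => (h g f₁).1) (fun g => (h g f₂).1)
    (fun g => ?_) g₁ g₂
  rw [(h g f₁).2 f₂, mul_right_comm]

end ProjectiveRep

end FormalDegree

section Frames

lemma exists_leftInverse_of_le_norm_sq {𝕜 E F : Type*} [RCLike 𝕜] [NormedAddCommGroup E]
    [InnerProductSpace 𝕜 E] [CompleteSpace E] [NormedAddCommGroup F] [InnerProductSpace 𝕜 F]
    {L : E →L[𝕜] F} {A : ℝ} (hA : 0 < A) (hL : ∀ f, A * ‖f‖ ^ 2 ≤ ‖L f‖ ^ 2) :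
    ∃ D : F →ₗ[𝕜] E, (∀ f, D (L f) = f) ∧ ∀ x, A * ‖D x‖ ^ 2 ≤ ‖x‖ ^ 2 := by
  have hanti : AntilipschitzWith (Real.toNNReal (√A)⁻¹) L := by
    refine ContinuousLinearMap.antilipschitz_of_bound L fun f => ?_
    rw [Real.coe_toNNReal _ (by positivity), inv_mul_eq_div, le_div_iff₀ (by positivity)]
    refine le_of_sq_le_sq ?_ (norm_nonneg _)
    rw [mul_pow, Real.sq_sqrt hA.le, mul_comm]
    exact hL f
  let R := LinearMap.range L.toLinearMap
  have : CompleteSpace R :=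
    completeSpace_coe_iff_isComplete.2 (hanti.isComplete_range L.uniformContinuous)
  let e := LinearEquiv.ofInjective L.toLinearMap hanti.injective
  refine ⟨e.symm.toLinearMap ∘ₗ R.orthogonalProjectionOnto.toLinearMap, fun f => ?_, fun x => ?_⟩
  · exact e.symm_apply_eq.2 (R.orthogonalProjectionOnto_mem_subspace_eq_self (e f))
  · calc A * ‖e.symm (R.orthogonalProjectionOnto x)‖ ^ 2
        ≤ ‖L (e.symm (R.orthogonalProjectionOnto x))‖ ^ 2 := hL _
      _ = ‖R.orthogonalProjectionOnto x‖ ^ 2 :=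
        congrArg (fun r : R => ‖r‖ ^ 2) (e.apply_symm_apply (R.orthogonalProjectionOnto x))
      _ ≤ ‖x‖ ^ 2 := by gcongr; exact R.norm_orthogonalProjectionOnto_apply_le x

lemma ofReal_lp_norm_sq {ι : Type*} (x : lp (fun _ : ι => ℂ) 2) :
    ENNReal.ofReal (‖x‖ ^ 2) = ∑' i, ‖x i‖ₑ ^ 2 := by
  have hsum := lp.hasSum_norm (p := 2) (by simp) x
  simp only [ENNReal.toReal_ofNat, Real.rpow_ofNat] at hsum
  rw [← hsum.tsum_eq, ENNReal.ofReal_tsum_of_nonneg (fun i => by positivity) hsum.summable]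
  simp_rw [ENNReal.ofReal_pow (norm_nonneg _), ofReal_norm]

variable {H ι : Type*} [NormedAddCommGroup H] [InnerProductSpace ℂ H] {e : ι → H} {A B : ℝ}

lemma exists_analysis_of_bessel (hB : 0 ≤ B)
    (h : ∀ f, ∑' i, ‖(inner ℂ (e i) f : ℂ)‖ₑ ^ 2 ≤ ENNReal.ofReal (B * ‖f‖ ^ 2)) :
    ∃ L : H →L[ℂ] lp (fun _ : ι => ℂ) 2, ∀ f i, L f i = inner ℂ (e i) f := by
  have hmem (f : H) : Memℓp (fun i => (inner ℂ (e i) f : ℂ)) 2 := by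
    refine memℓp_gen ?_
    simpa using ENNReal.summable_toReal ((h f).trans_lt ENNReal.ofReal_lt_top).ne
  let L : H →ₗ[ℂ] lp (fun _ : ι => ℂ) 2 :=
    { toFun := fun f => ⟨fun i => inner ℂ (e i) f, hmem f⟩
      map_add' := fun f f' => lp.ext (funext fun i => inner_add_right _ _ _)
      map_smul' := fun c f => lp.ext (funext fun i => inner_smul_right _ _ _) }
  refine ⟨L.mkContinuous (√B) fun f => ?_, fun f i => rfl⟩
  have hL : ‖L f‖ ^ 2 ≤ B * ‖f‖ ^ 2 := by
    rw [← ENNReal.ofReal_le_ofReal_iff (by positivity)]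
    exact (ofReal_lp_norm_sq _).trans_le (h f)
  refine le_of_sq_le_sq ?_ (by positivity)
  rwa [mul_pow, Real.sq_sqrt hB]

variable [CompleteSpace H]

/- The subspace is spanned by the vectors of a dual frame with indices in `s`. -/
lemma exists_submodule_of_frame (hA : 0 < A) (hB : 0 ≤ B)
    (h : ∀ f, ENNReal.ofReal (A * ‖f‖ ^ 2) ≤ ∑' i, ‖(inner ℂ (e i) f : ℂ)‖ₑ ^ 2 ∧
      ∑' i, ‖(inner ℂ (e i) f : ℂ)‖ₑ ^ 2 ≤ ENNReal.ofReal (B * ‖f‖ ^ 2)) (s : Finset ι) :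
    ∃ V : Submodule ℂ H, FiniteDimensional ℂ V ∧ Module.finrank ℂ V ≤ s.card ∧
      ∀ f, ∃ v ∈ V, ‖f - v‖ₑ ^ 2 ≤
        ENNReal.ofReal A⁻¹ * ∑' i : ((s : Set ι)ᶜ : Set ι), ‖(inner ℂ (e i) f : ℂ)‖ₑ ^ 2 := by
  classical
  obtain ⟨L, hL⟩ := exists_analysis_of_bessel hB fun f => (h f).2
  obtain ⟨D, hDL, hD⟩ := exists_leftInverse_of_le_norm_sq (L := L) hA fun f => by
    rw [← ENNReal.ofReal_le_ofReal_iff (by positivity), ofReal_lp_norm_sq]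
    simpa only [hL] using (h f).1
  let dual : ι → H := fun i => D (lp.single (E := fun _ : ι => ℂ) 2 i 1)
  refine ⟨Submodule.span ℂ (s.image dual : Set H), FiniteDimensional.span_finset ℂ _,
    (finrank_span_finset_le_card _).trans Finset.card_image_le, fun f => ?_⟩
  set x := ∑ i ∈ s, lp.single (E := fun _ : ι => ℂ) 2 i (L f i) with hx
  refine ⟨D x, ?_, ?_⟩
  · rw [hx, map_sum]
    refine Submodule.sum_mem _ fun i hi => ?_
    have hsingle : lp.single (E := fun _ : ι => ℂ) 2 i (L f i) =
        L f i • lp.single (E := fun _ : ι => ℂ) 2 i 1 := by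
      rw [← lp.single_smul, smul_eq_mul, mul_one]
    rw [hsingle, map_smul]
    exact Submodule.smul_mem _ _ (Submodule.subset_span (Finset.mem_image_of_mem dual hi))
  · have hcoord (j : ι) : ‖(L f - x) j‖ₑ ^ 2 =
        (s : Set ι)ᶜ.indicator (fun i => ‖(inner ℂ (e i) f : ℂ)‖ₑ ^ 2) j := by
      rw [lp.coeFn_sub, Pi.sub_apply, hx, lp.coeFn_sum, Finset.sum_apply]
      simp_rw [lp.single_apply, Pi.single_apply, Finset.sum_ite_eq, hL]
      by_cases hj : j ∈ s <;> simp [hj]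
    have hsub : ‖f - D x‖ ^ 2 ≤ A⁻¹ * ‖L f - x‖ ^ 2 := by
      rw [inv_mul_eq_div, le_div_iff₀' hA, ← hDL f, ← map_sub, hDL]
      exact hD _
    rw [tsum_subtype _ (fun i => ‖(inner ℂ (e i) f : ℂ)‖ₑ ^ 2), ← tsum_congr hcoord,
      ← ofReal_lp_norm_sq, ← ENNReal.ofReal_mul (by positivity), ← ofReal_norm,
      ← ENNReal.ofReal_pow (norm_nonneg _)]
    exact ENNReal.ofReal_le_ofReal hsub

end Frames

section DimensionCount

lemma norm_sq_le_sum_norm_inner_sq_add {𝕜 E ι : Type*} [RCLike 𝕜] [NormedAddCommGroup E]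
    [InnerProductSpace 𝕜 E] [Fintype ι] {V : Submodule 𝕜 E} (b : OrthonormalBasis ι 𝕜 V) (f : E)
    {v : E} (hv : v ∈ V) :
    ‖f‖ ^ 2 ≤ ∑ i, ‖(inner 𝕜 f (b i : E) : 𝕜)‖ ^ 2 + ‖f - v‖ ^ 2 := by
  have : FiniteDimensional 𝕜 V := b.toBasis.finiteDimensional_of_finite
  have hproj : ‖V.orthogonalProjectionOnto f‖ ^ 2 = ∑ i, ‖(inner 𝕜 f (b i : E) : 𝕜)‖ ^ 2 := by
    rw [← b.sum_sq_norm_inner_left]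
    simp_rw [V.inner_orthogonalProjectionOnto_eq_of_mem_right]
  have hperp : ‖Vᗮ.orthogonalProjectionOnto f‖ ≤ ‖f - v‖ := by
    rw [← sub_zero (Vᗮ.orthogonalProjectionOnto f),
      ← V.orthogonalProjectionOnto_orthogonal_apply_eq_zero hv, ← map_sub]
    exact Vᗮ.norm_orthogonalProjectionOnto_apply_le _
  rw [V.norm_sq_eq_add_norm_sq_projection f, hproj]
  gcongr

namespace ProjectiveRep

variable {G H : Type*} [Group G] [TopologicalSpace G] [MeasurableSpace G]
  [NormedAddCommGroup H] [InnerProductSpace ℂ H] {π : ProjectiveRep G H} {μ : Measure G}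

lemma IsFormalDegree.measure_mul_norm_sq_le {d : ℝ} (hd : π.IsFormalDegree μ d)
    (V : Submodule ℂ H) [FiniteDimensional ℂ V] (g : H) {v : G → H} (hv : ∀ y, v y ∈ V)
    (K : Set G) :
    μ K * ENNReal.ofReal (‖g‖ ^ 2) ≤
      Module.finrank ℂ V * ENNReal.ofReal (d⁻¹ * ‖g‖ ^ 2) +
        ∫⁻ y in K, ‖π.op y g - v y‖ₑ ^ 2 ∂μ := by
  let b := stdOrthonormalBasis ℂ V
  have hmeas (i) : Measurable fun y => ‖π.coeff g (b i) y‖ₑ ^ 2 :=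
    (π.stronglyMeasurable_coeff g (b i)).measurable.enorm.pow_const 2
  have hpointwise (y : G) : ENNReal.ofReal (‖g‖ ^ 2) ≤
      ∑ i, ‖π.coeff g (b i) y‖ₑ ^ 2 + ‖π.op y g - v y‖ₑ ^ 2 := by
    simp_rw [← ofReal_norm, ← ENNReal.ofReal_pow (norm_nonneg _)]
    rw [← ENNReal.ofReal_sum_of_nonneg fun i _ => by positivity,
      ← ENNReal.ofReal_add (by positivity) (by positivity), ← (π.op y).norm_map g]
    exact ENNReal.ofReal_le_ofReal (norm_sq_le_sum_norm_inner_sq_add b _ (hv y))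
  have hcoeff (i) : ∫⁻ y in K, ‖π.coeff g (b i) y‖ₑ ^ 2 ∂μ ≤ ENNReal.ofReal (d⁻¹ * ‖g‖ ^ 2) := by
    have hbi : ‖(b i : H)‖ = 1 := b.orthonormal.1 i
    refine (setLIntegral_le_lintegral _ _).trans_eq ?_
    rw [hd.lintegral_enorm_coeff_sq, hbi, one_pow, mul_one]
  calc μ K * ENNReal.ofReal (‖g‖ ^ 2)
      = ∫⁻ _y in K, ENNReal.ofReal (‖g‖ ^ 2) ∂μ := by rw [setLIntegral_const, mul_comm]
    _ ≤ ∫⁻ y in K, (∑ i, ‖π.coeff g (b i) y‖ₑ ^ 2 + ‖π.op y g - v y‖ₑ ^ 2) ∂μ :=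
        lintegral_mono hpointwise
    _ = ∑ i, ∫⁻ y in K, ‖π.coeff g (b i) y‖ₑ ^ 2 ∂μ +
          ∫⁻ y in K, ‖π.op y g - v y‖ₑ ^ 2 ∂μ := by
        rw [lintegral_add_left (Finset.measurable_sum _ fun i _ => hmeas i),
          lintegral_finsetSum _ fun i _ => hmeas i]
    _ ≤ ∑ _i : Fin (Module.finrank ℂ V), ENNReal.ofReal (d⁻¹ * ‖g‖ ^ 2) +
          ∫⁻ y in K, ‖π.op y g - v y‖ₑ ^ 2 ∂μ := by
        gcongr with i
        exact hcoeff i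
    _ = _ := by rw [Finset.sum_const, Finset.card_univ, Fintype.card_fin, nsmul_eq_mul]

lemma IsFrameWithBounds.measure_mul_norm_sq_le [CompleteSpace H] {d : ℝ}
    (hd : π.IsFormalDegree μ d) {Λ : Set G} {g : H} {A B : ℝ} (hΛ : π.IsFrameWithBounds Λ g A B)
    {K : Set G} (hfin : (Λ ∩ K).Finite) :
    μ K * ENNReal.ofReal (‖g‖ ^ 2) ≤
      (Λ ∩ K).ncard * ENNReal.ofReal (d⁻¹ * ‖g‖ ^ 2) +
        ENNReal.ofReal A⁻¹ *
          ∫⁻ y in K, ∑' l : (Λ \ K : Set G), ‖π.coeff g g (y⁻¹ * l)‖ₑ ^ 2 ∂μ := by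
  obtain ⟨hA, hB, hframe⟩ := hΛ
  rw [← Subtype.image_preimage_coe] at hfin
  obtain ⟨s, hs⟩ := (hfin.of_finite_image Subtype.val_injective.injOn).exists_finset_coe
  obtain ⟨V, _, hdim, hV⟩ := exists_submodule_of_frame hA hB.le (e := fun l : Λ => π.op l g)
    hframe s
  choose v hvV hv using fun y => hV (π.op y g)
  have hcard : s.card = (Λ ∩ K).ncard := by
    rw [← Subtype.image_preimage_coe, Set.ncard_image_of_injective _ Subtype.val_injective, ← hs,
      Set.ncard_coe_finset]
  have herror (y : G) : ‖π.op y g - v y‖ₑ ^ 2 ≤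
      ENNReal.ofReal A⁻¹ * ∑' l : (Λ \ K : Set G), ‖π.coeff g g (y⁻¹ * l)‖ₑ ^ 2 := by
    refine (hv y).trans_eq (congrArg _ ?_)
    have hindicator (l : Λ) : (s : Set Λ)ᶜ.indicator
        (fun l : Λ => ‖(inner ℂ (π.op l g) (π.op y g) : ℂ)‖ₑ ^ 2) l =
        Kᶜ.indicator (fun l => ‖π.coeff g g (y⁻¹ * l)‖ₑ ^ 2) (l : G) := by
      rw [hs, ← Set.preimage_compl]
      by_cases hl : (l : G) ∈ K
      · rw [Set.indicator_of_notMem (by simpa), Set.indicator_of_notMem (by simpa)]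
      · rw [Set.indicator_of_mem (by simpa), Set.indicator_of_mem (by simpa), ← ofReal_norm,
          ← ofReal_norm (π.coeff g g _), ← norm_coeff_op_left, coeff]
    rw [tsum_subtype (s : Set Λ)ᶜ fun l : Λ => ‖(inner ℂ (π.op l g) (π.op y g) : ℂ)‖ₑ ^ 2,
      tsum_congr hindicator, tsum_subtype Λ (Kᶜ.indicator _), Set.indicator_indicator,
      ← Set.sdiff_eq, ← tsum_subtype (Λ \ K)]
  calc μ K * ENNReal.ofReal (‖g‖ ^ 2)
      ≤ Module.finrank ℂ V * ENNReal.ofReal (d⁻¹ * ‖g‖ ^ 2) +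
        ∫⁻ y in K, ‖π.op y g - v y‖ₑ ^ 2 ∂μ := hd.measure_mul_norm_sq_le V g hvV K
    _ ≤ _ := by
      rw [← lintegral_const_mul' _ _ ENNReal.ofReal_ne_top, ← hcard]
      gcongr with y
      exact herror y

end ProjectiveRep

end DimensionCount

section RelativeSeparation

/-- The relative separation `sup_x #(Λ ∩ xS)` of the point set `Λ`, measured with the window `S`;
it is `⊤` if the cardinalities are unbounded. -/
noncomputable def relSeparation {G : Type*} [Group G] (S Λ : Set G) : ℕ∞ :=
  ⨆ x : G, (Λ ∩ x • S).encard

variable {G : Type*} [Group G]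

lemma encard_inter_smul_le_relSeparation (S Λ : Set G) (x : G) :
    (Λ ∩ x • S).encard ≤ relSeparation S Λ :=
  le_iSup (fun x => (Λ ∩ x • S).encard) x

lemma relSeparation_mono {S T Λ Γ : Set G} (hST : S ⊆ T) (hΛΓ : Λ ⊆ Γ) :
    relSeparation S Λ ≤ relSeparation T Γ :=
  iSup_mono fun _ =>
    Set.encard_le_encard (Set.inter_subset_inter hΛΓ (Set.smul_set_mono hST))

lemma relSeparation_le_card_mul {S U : Set G} {t : Finset G} (h : S ⊆ ⋃ a ∈ t, a • U)
    (Λ : Set G) : relSeparation S Λ ≤ t.card * relSeparation U Λ := by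
  refine iSup_le fun x => ?_
  have hcover : Λ ∩ x • S ⊆ ⋃ a ∈ t, Λ ∩ (x * a) • U := by
    rw [← Set.inter_iUnion₂]
    refine Set.inter_subset_inter_right _ ?_
    simpa only [Set.smul_set_iUnion₂, mul_smul] using Set.smul_set_mono (a := x) h
  calc (Λ ∩ x • S).encard
      ≤ (⋃ a ∈ t, Λ ∩ (x * a) • U).encard := Set.encard_le_encard hcover
    _ ≤ ∑ a ∈ t, (Λ ∩ (x * a) • U).encard := Finset.set_encard_biUnion_le _ _
    _ ≤ ∑ _a ∈ t, relSeparation U Λ :=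
        Finset.sum_le_sum fun a _ => encard_inter_smul_le_relSeparation U Λ (x * a)
    _ = t.card * relSeparation U Λ := by rw [Finset.sum_const, nsmul_eq_mul]

lemma finite_inter_of_relSeparation_ne_top {S Λ : Set G} (h : relSeparation S Λ ≠ ⊤) :
    (Λ ∩ S).Finite := by
  rw [← Set.encard_lt_top_iff, ← one_smul G S]
  exact (encard_inter_smul_le_relSeparation S Λ 1).trans_lt h.lt_top

lemma exists_finset_subset_biUnion_smul [TopologicalSpace G] [ContinuousMul G] {S U : Set G}
    (hS : IsCompact S) (hU : U ∈ 𝓝 (1 : G)) : ∃ t : Finset G, S ⊆ ⋃ x ∈ t, x • U := by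
  obtain ⟨t, -, ht⟩ := hS.elim_nhds_subcover (fun x => x • U) fun x _ => by
    simpa using smul_mem_nhds_smul x hU
  exact ⟨t, ht⟩

end RelativeSeparation

namespace ProjectiveRep

section Bessel

variable {G H : Type*} [Group G] [TopologicalSpace G] [MeasurableSpace G]
  [NormedAddCommGroup H] [InnerProductSpace ℂ H] {π : ProjectiveRep G H} {Λ : Set G} {g : H}
  {A B : ℝ}

lemma IsFrameWithBounds.smul (h : π.IsFrameWithBounds Λ g A B) (x : G) :
    π.IsFrameWithBounds (x • Λ) g A B := by
  obtain ⟨hA, hB, hframe⟩ := h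
  refine ⟨hA, hB, fun f => ?_⟩
  have hsum : ∑' l : (x • Λ : Set G), ‖π.coeff g f l‖ₑ ^ 2 =
      ∑' l : Λ, ‖π.coeff g ((π.op x).symm f) l‖ₑ ^ 2 := by
    refine (tsum_image (fun l => ‖π.coeff g f l‖ₑ ^ 2) (mul_right_injective x).injOn).trans
      (tsum_congr fun l => ?_)
    rw [← ofReal_norm, norm_coeff_mul_left, ofReal_norm]
  simpa only [hsum, LinearIsometryEquiv.norm_map] using hframe ((π.op x).symm f)

lemma IsFrameWithBounds.ne_zero [Nontrivial H] (h : π.IsFrameWithBounds Λ g A B) : g ≠ 0 := by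
  rintro rfl
  obtain ⟨f, hf⟩ := exists_ne (0 : H)
  have hlower := (h.2.2 f).1
  simp only [coeff, map_zero, inner_zero_left, enorm_zero, ne_eq, OfNat.ofNat_ne_zero,
    not_false_eq_true, zero_pow, tsum_zero, nonpos_iff_eq_zero, ENNReal.ofReal_eq_zero] at hlower
  exact hlower.not_gt (mul_pos h.1 (pow_pos (norm_pos_iff.2 hf) 2))

/-- The family `(π(λ) g)_{λ ∈ Λ}` is a Bessel sequence with bound `B`, i.e. satisfies the upper
frame inequality; it alone controls the relative separation of `Λ`. -/
def IsBesselWithBound (π : ProjectiveRep G H) (Λ : Set G) (g : H) (B : ℝ) : Prop :=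
  ∀ f : H, ∑' l : Λ, ‖π.coeff g f l‖ₑ ^ 2 ≤ ENNReal.ofReal (B * ‖f‖ ^ 2)

lemma IsFrameWithBounds.isBesselWithBound (h : π.IsFrameWithBounds Λ g A B) :
    π.IsBesselWithBound Λ g B :=
  fun f => (h.2.2 f).2

lemma IsBesselWithBound.sq_mul_relSeparation_le (h : π.IsBesselWithBound Λ g B) (ε : ℝ≥0∞) :
    ε ^ 2 * relSeparation {x | ε < ‖π.coeff g g x‖ₑ} Λ ≤ ENNReal.ofReal (B * ‖g‖ ^ 2) := by
  set U := {x | ε < ‖π.coeff g g x‖ₑ}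
  rw [relSeparation, ENat.toENNReal_iSup, ENNReal.mul_iSup]
  refine iSup_le fun y => ?_
  have hlarge (l : (Λ ∩ y • U : Set G)) : ε ^ 2 ≤ ‖π.coeff g (π.op y g) l‖ₑ ^ 2 := by
    have hl : y⁻¹ * (l : G) ∈ U := Set.mem_smul_set_iff_inv_smul_mem.1 l.2.2
    rw [← ofReal_norm (π.coeff g (π.op y g) l), norm_coeff_op_left, ofReal_norm]
    gcongr
    exact le_of_lt hl
  calc ε ^ 2 * (Λ ∩ y • U).encard = ∑' _ : (Λ ∩ y • U : Set G), ε ^ 2 := by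
        rw [ENNReal.tsum_set_const, mul_comm]
    _ ≤ ∑' l : (Λ ∩ y • U : Set G), ‖π.coeff g (π.op y g) l‖ₑ ^ 2 := ENNReal.tsum_le_tsum hlarge
    _ ≤ ∑' l : Λ, ‖π.coeff g (π.op y g) l‖ₑ ^ 2 :=
        ENNReal.tsum_mono_subtype (fun l => ‖π.coeff g (π.op y g) l‖ₑ ^ 2) Set.inter_subset_left
    _ ≤ ENNReal.ofReal (B * ‖g‖ ^ 2) := by
        simpa only [LinearIsometryEquiv.norm_map] using h (π.op y g)

variable [IsTopologicalGroup G] [LocallyCompactSpace G] [SecondCountableTopology G] [BorelSpace G]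

lemma exists_relSeparation_le (π : ProjectiveRep G H) (hg : g ≠ 0) (B : ℝ) {S : Set G}
    (hS : IsCompact S) :
    ∃ N : ℕ, ∀ Λ, π.IsBesselWithBound Λ g B → relSeparation S Λ ≤ N := by
  obtain ⟨ε, hε, hεg⟩ : ∃ ε, 0 < ε ∧ ε < ‖π.coeff g g 1‖ₑ := by
    refine exists_between ?_
    rw [← ofReal_norm, norm_coeff_one, ENNReal.ofReal_pos, norm_pos_iff]
    exact inner_self_ne_zero.2 hg
  let U : Set G := {x | ε < ‖π.coeff g g x‖ₑ}
  have hU : U ∈ 𝓝 (1 : G) :=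
    (isOpen_lt continuous_const (π.continuous_enorm_coeff g g)).mem_nhds hεg
  obtain ⟨t, ht⟩ := exists_finset_subset_biUnion_smul hS hU
  obtain ⟨M, hM⟩ := ENNReal.exists_nat_gt (r := ENNReal.ofReal (B * ‖g‖ ^ 2) / ε ^ 2)
    (ENNReal.div_ne_top ENNReal.ofReal_ne_top (pow_ne_zero 2 hε.ne'))
  refine ⟨t.card * M, fun Λ hΛ => (relSeparation_le_card_mul ht Λ).trans ?_⟩
  rw [Nat.cast_mul]
  gcongr
  rw [← ENat.toENNReal_le, ENat.toENNReal_coe]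
  refine le_trans ?_ hM.le
  rw [ENNReal.le_div_iff_mul_le (Or.inl (pow_ne_zero 2 hε.ne'))
    (Or.inl (ENNReal.pow_ne_top (hεg.trans_le le_top).ne)), mul_comm]
  exact hΛ.sq_mul_relSeparation_le ε

end Bessel

end ProjectiveRep

section LocalMax

variable {G : Type*} [Group G] {F : G → ℂ}

lemma enorm_le_localMax {Q : Set G} (x : G) {q : G} (hq : q ∈ Q) :
    ‖F (x * q)‖ₑ ≤ localMax Q F x :=
  le_iSup₂_of_le q hq le_rfl

lemma localMax_sq_le_sum {Q Q' : Set G} {t : Finset G} (ht : Q' ⊆ ⋃ a ∈ t, a • Q) (x : G) :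
    localMax Q' F x ^ 2 ≤ ∑ a ∈ t, localMax Q F (x * a) ^ 2 := by
  simp_rw [localMax, ENNReal.iSup_pow_of_ne_zero two_ne_zero]
  refine iSup₂_le fun z hz => ?_
  obtain ⟨a, ha, q, hq, rfl⟩ := Set.mem_iUnion₂.1 (ht hz)
  refine le_trans ?_ (Finset.single_le_sum (fun _ _ => zero_le) ha)
  exact le_iSup₂_of_le q hq (by simp only [smul_eq_mul, mul_assoc, le_refl])

variable [TopologicalSpace G] [MeasurableSpace G] [BorelSpace G]

lemma measurable_localMax [ContinuousMul G] (hF : Continuous fun x => ‖F x‖ₑ) (Q : Set G) :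
    Measurable (localMax Q F) :=
  (lowerSemicontinuous_biSup fun z _ =>
    (hF.comp (continuous_mul_const z)).lowerSemicontinuous).measurable

lemma lintegral_localMax_sq_lt_top [ContinuousMul G] {μ : Measure G} [μ.IsMulRightInvariant]
    (hF : Continuous fun x => ‖F x‖ₑ) {Q Q' : Set G} (hQ : Q ∈ 𝓝 (1 : G))
    (hQ' : IsCompact (closure Q')) (h : ∫⁻ x, localMax Q F x ^ 2 ∂μ < ∞) :
    ∫⁻ x, localMax Q' F x ^ 2 ∂μ < ∞ := by
  obtain ⟨t, ht⟩ := exists_finset_subset_biUnion_smul hQ' hQ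
  have hmeas (a : G) : Measurable fun x => localMax Q F (x * a) ^ 2 :=
    ((measurable_localMax hF Q).comp (measurable_mul_const a)).pow_const 2
  calc ∫⁻ x, localMax Q' F x ^ 2 ∂μ
      ≤ ∫⁻ x, ∑ a ∈ t, localMax Q F (x * a) ^ 2 ∂μ :=
        lintegral_mono (localMax_sq_le_sum (subset_closure.trans ht))
    _ = ∑ _a ∈ t, ∫⁻ x, localMax Q F x ^ 2 ∂μ := by
        rw [lintegral_finsetSum _ fun a _ => hmeas a]
        exact Finset.sum_congr rfl fun a _ =>
          lintegral_mul_right_eq_self (fun x => localMax Q F x ^ 2) a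
    _ < ∞ := ENNReal.sum_lt_top.2 fun _ _ => h

end LocalMax

section Sampling

variable {G : Type*} [Group G]

lemma tsum_indicator_smul (Λ U : Set G) (φ : G → ℝ≥0∞) (z : G) :
    ∑' l : Λ, ((l : G) • U).indicator φ z = (Λ ∩ z • U⁻¹).encard * φ z := by
  have hmem (l : G) : z ∈ l • U ↔ l ∈ z • U⁻¹ := by
    rw [Set.mem_smul_set_iff_inv_smul_mem, Set.mem_smul_set_iff_inv_smul_mem, Set.mem_inv,
      smul_eq_mul, smul_eq_mul, mul_inv_rev, inv_inv]
  have hindicator (l : G) : (l • U).indicator φ z = (z • U⁻¹).indicator (fun _ => φ z) l := by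
    by_cases hl : z ∈ l • U
    · rw [Set.indicator_of_mem hl, Set.indicator_of_mem ((hmem l).1 hl)]
    · rw [Set.indicator_of_notMem hl, Set.indicator_of_notMem (mt (hmem l).2 hl)]
  simp_rw [hindicator]
  rw [tsum_subtype Λ ((z • U⁻¹).indicator fun _ => φ z), Set.indicator_indicator,
    ← tsum_subtype (Λ ∩ z • U⁻¹) fun _ => φ z, ENNReal.tsum_set_const]

lemma tsum_indicator_smul_le (Λ U : Set G) (φ : G → ℝ≥0∞) (z : G) :
    ∑' l : Λ, ((l : G) • U).indicator φ z ≤ relSeparation U⁻¹ Λ * (Λ * U).indicator φ z := by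
  by_cases hz : z ∈ Λ * U
  · rw [tsum_indicator_smul, Set.indicator_of_mem hz]
    gcongr
    exact encard_inter_smul_le_relSeparation _ _ _
  · have hzero (l : Λ) : ((l : G) • U).indicator φ z = 0 :=
      Set.indicator_of_notMem (fun hl => hz (Set.smul_set_subset_mul l.2 hl)) φ
    simp only [hzero, tsum_zero, zero_le]

lemma measure_mul_tsum_le [TopologicalSpace G] [IsTopologicalGroup G] [MeasurableSpace G]
    [BorelSpace G] {μ : Measure G} [μ.IsMulLeftInvariant] {Λ U : Set G} (hU : IsOpen U)
    {w φ : G → ℝ≥0∞} (hφ : Measurable φ) (hw : ∀ l ∈ Λ, ∀ u ∈ U, w l ≤ φ (l * u)) :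
    μ U * ∑' l : Λ, w l ≤ relSeparation U⁻¹ Λ * ∫⁻ z in Λ * U, φ z ∂μ := by
  have hUmeas (l : G) : MeasurableSet (l • U) := (hU.smul l).measurableSet
  have hterm (l : Λ) : μ U * w l ≤ ∫⁻ z, ((l : G) • U).indicator φ z ∂μ := by
    rw [lintegral_indicator (hUmeas l), ← measure_smul μ (l : G) U, mul_comm, ← setLIntegral_const]
    refine setLIntegral_mono' (hUmeas l) ?_
    rintro _ ⟨u, hu, rfl⟩
    exact hw l l.2 u hu
  rw [ENNReal.tsum_eq_iSup_sum, ENNReal.mul_iSup]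
  refine iSup_le fun s => ?_
  calc μ U * ∑ l ∈ s, w l ≤ ∑ l ∈ s, ∫⁻ z, ((l : G) • U).indicator φ z ∂μ := by
        rw [Finset.mul_sum]
        exact Finset.sum_le_sum fun l _ => hterm l
    _ = ∫⁻ z, ∑ l ∈ s, ((l : G) • U).indicator φ z ∂μ :=
        (lintegral_finsetSum _ fun (l : Λ) _ => hφ.indicator (hUmeas l)).symm
    _ ≤ ∫⁻ z, relSeparation U⁻¹ Λ * (Λ * U).indicator φ z ∂μ :=
        lintegral_mono fun z => (ENNReal.sum_le_tsum s).trans (tsum_indicator_smul_le Λ U φ z)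
    _ = relSeparation U⁻¹ Λ * ∫⁻ z in Λ * U, φ z ∂μ := by
        have hΛU : MeasurableSet (Λ * U) := hU.mul_left.measurableSet
        rw [lintegral_const_mul _ (hφ.indicator hΛU), lintegral_indicator hΛU]

end Sampling

section Limits

lemma exists_isCompact_setLIntegral_compl_le {X : Type*} [TopologicalSpace X] [SigmaCompactSpace X]
    [T2Space X] [MeasurableSpace X] [OpensMeasurableSpace X] {μ : Measure X} {φ : X → ℝ≥0∞}
    (hφ : ∫⁻ x, φ x ∂μ ≠ ∞) {ε : ℝ≥0∞} (hε : 0 < ε) :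
    ∃ L, IsCompact L ∧ ∫⁻ x in Lᶜ, φ x ∂μ ≤ ε := by
  have hmeas (n : ℕ) : MeasurableSet (compactCovering X n)ᶜ :=
    (isCompact_compactCovering X n).isClosed.measurableSet.compl
  have hanti : Antitone fun n => (compactCovering X n)ᶜ := fun m n hmn =>
    Set.compl_subset_compl.2 (compactCovering_subset X hmn)
  have : IsFiniteMeasure (μ.withDensity φ) := isFiniteMeasure_withDensity hφ
  have htendsto := tendsto_measure_iInter_atTop (μ := μ.withDensity φ)
    (fun n => (hmeas n).nullMeasurableSet) hanti ⟨0, measure_ne_top _ _⟩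
  rw [← Set.compl_iUnion, iUnion_compactCovering, Set.compl_univ, measure_empty] at htendsto
  obtain ⟨n, hn⟩ := (htendsto.eventually (ge_mem_nhds hε)).exists
  refine ⟨compactCovering X n, isCompact_compactCovering X n, ?_⟩
  rwa [← withDensity_apply _ (hmeas n)]

lemma isLittleO_toReal_of_tendsto_div {α : Type*} {l : Filter α} {a b : α → ℝ≥0∞}
    (h : Tendsto (fun n => a n / b n) l (𝓝 0)) (hb0 : ∀ n, b n ≠ 0) (hb : ∀ n, b n ≠ ∞) :
    (fun n => (a n).toReal) =o[l] fun n => (b n).toReal := by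
  refine isLittleO_of_tendsto (fun n hn => ?_) ?_
  · exact absurd hn (ENNReal.toReal_pos (hb0 n) (hb n)).ne'
  · simpa only [Function.comp_def, ENNReal.toReal_div, ENNReal.toReal_zero] using
      (ENNReal.tendsto_toReal ENNReal.zero_ne_top).comp h

end Limits

section FolnerIntegrals

variable {G : Type*} [Group G]

lemma compl_mul_subset_union {K L Q : Set G} (hQL : Q ⊆ L) {y : G} (hy : y ∈ K) :
    Kᶜ * Q ⊆ K * L ∩ (Kᶜ * L) ∪ y • Lᶜ := by
  intro z hz
  by_cases hzL : z ∈ y • L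
  · exact Or.inl ⟨Set.smul_set_subset_mul hy hzL, Set.mul_subset_mul_left hQL hz⟩
  · rw [Set.smul_set_compl]
    exact Or.inr hzL

variable [MeasurableSpace G] {μ : Measure G}

lemma setLIntegral_smul_inv_mul [MeasurableMul G] [μ.IsMulLeftInvariant] (φ : G → ℝ≥0∞)
    (y : G) (E : Set G) : ∫⁻ z in y • E, φ (y⁻¹ * z) ∂μ = ∫⁻ x in E, φ x ∂μ := by
  rw [← Set.preimage_smul_inv]
  exact (measurePreserving_mul_left μ y⁻¹).setLIntegral_comp_preimage_emb
    (measurableEmbedding_mulLeft y⁻¹) φ E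

lemma lintegral_setLIntegral_inv_mul_le_measure_left_mul [MeasurableMul G]
    [μ.IsMulLeftInvariant] (φ : G → ℝ≥0∞) (K E : Set G) :
    ∫⁻ y in K, ∫⁻ z in E, φ (y⁻¹ * z) ∂μ ∂μ ≤ μ K * ∫⁻ x, φ x ∂μ :=
  calc ∫⁻ y in K, ∫⁻ z in E, φ (y⁻¹ * z) ∂μ ∂μ ≤ ∫⁻ _y in K, ∫⁻ x, φ x ∂μ ∂μ :=
        lintegral_mono fun y => (setLIntegral_le_lintegral _ _).trans_eq
          (lintegral_mul_left_eq_self φ y⁻¹)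
    _ = μ K * ∫⁻ x, φ x ∂μ := by rw [setLIntegral_const, mul_comm]

lemma lintegral_setLIntegral_inv_mul_le_measure_right_mul [MeasurableMul₂ G] [MeasurableInv G]
    [SFinite μ] [μ.IsMulRightInvariant] [μ.IsInvInvariant] {φ : G → ℝ≥0∞} (hφ : Measurable φ)
    (K E : Set G) :
    ∫⁻ y in K, ∫⁻ z in E, φ (y⁻¹ * z) ∂μ ∂μ ≤ μ E * ∫⁻ x, φ x ∂μ :=
  calc ∫⁻ y in K, ∫⁻ z in E, φ (y⁻¹ * z) ∂μ ∂μ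
      ≤ ∫⁻ y, ∫⁻ z in E, φ (y⁻¹ * z) ∂μ ∂μ := setLIntegral_le_lintegral _ _
    _ = ∫⁻ z in E, ∫⁻ y, φ (y⁻¹ * z) ∂μ ∂μ :=
        lintegral_lintegral_swap (hφ.comp (measurable_fst.inv.mul measurable_snd)).aemeasurable
    _ = ∫⁻ _z in E, ∫⁻ x, φ x ∂μ ∂μ := lintegral_congr fun z => by
        rw [lintegral_inv_eq_self fun y => φ (y * z), lintegral_mul_right_eq_self φ z]
    _ = μ E * ∫⁻ x, φ x ∂μ := by rw [setLIntegral_const, mul_comm]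

lemma lintegral_setLIntegral_compl_mul_le [MeasurableMul₂ G] [MeasurableInv G] [SFinite μ]
    [μ.IsMulLeftInvariant] [μ.IsMulRightInvariant] [μ.IsInvInvariant] {φ : G → ℝ≥0∞}
    (hφ : Measurable φ) {K L Q : Set G} (hK : MeasurableSet K) (hQL : Q ⊆ L) :
    ∫⁻ y in K, ∫⁻ z in Kᶜ * Q, φ (y⁻¹ * z) ∂μ ∂μ ≤
      μ (K * L ∩ (Kᶜ * L)) * ∫⁻ x, φ x ∂μ + μ K * ∫⁻ x in Lᶜ, φ x ∂μ := by
  set E := K * L ∩ (Kᶜ * L)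
  have hsplit (y : G) (hy : y ∈ K) : ∫⁻ z in Kᶜ * Q, φ (y⁻¹ * z) ∂μ ≤
      ∫⁻ z in E, φ (y⁻¹ * z) ∂μ + ∫⁻ x in Lᶜ, φ x ∂μ := by
    rw [← setLIntegral_smul_inv_mul φ y]
    exact (lintegral_mono_set (compl_mul_subset_union hQL hy)).trans (lintegral_union_le _ _ _)
  calc ∫⁻ y in K, ∫⁻ z in Kᶜ * Q, φ (y⁻¹ * z) ∂μ ∂μ
      ≤ ∫⁻ y in K, (∫⁻ z in E, φ (y⁻¹ * z) ∂μ + ∫⁻ x in Lᶜ, φ x ∂μ) ∂μ :=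
        setLIntegral_mono' hK hsplit
    _ = ∫⁻ y in K, ∫⁻ z in E, φ (y⁻¹ * z) ∂μ ∂μ + μ K * ∫⁻ x in Lᶜ, φ x ∂μ := by
        rw [lintegral_add_right _ measurable_const, setLIntegral_const, mul_comm]
    _ ≤ μ E * ∫⁻ x, φ x ∂μ + μ K * ∫⁻ x in Lᶜ, φ x ∂μ := by
        gcongr
        exact lintegral_setLIntegral_inv_mul_le_measure_right_mul hφ K E

variable [TopologicalSpace G]

lemma IsStrongFolner.tendsto_lintegral_setLIntegral_div [IsTopologicalGroup G]
    [SecondCountableTopology G] [SigmaCompactSpace G] [T2Space G] [BorelSpace G]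
    [IsFiniteMeasureOnCompacts μ] [SFinite μ]
    [μ.IsMulLeftInvariant] [μ.IsMulRightInvariant] [μ.IsInvInvariant] {K : ℕ → Set G}
    (hK : IsStrongFolner μ K) {φ : G → ℝ≥0∞} (hφ : Measurable φ) (hfinite : ∫⁻ x, φ x ∂μ ≠ ∞)
    {Q : Set G} (hQ : IsCompact (closure Q)) :
    Tendsto (fun n => (∫⁻ y in K n, ∫⁻ z in (K n)ᶜ * Q, φ (y⁻¹ * z) ∂μ ∂μ) / μ (K n)) atTop
      (𝓝 0) := by
  refine ENNReal.tendsto_nhds_zero.2 fun ε hε => ?_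
  have hε2 : 0 < ε / 2 := ENNReal.half_pos hε.ne'
  obtain ⟨L₀, hL₀, htail₀⟩ := exists_isCompact_setLIntegral_compl_le hfinite hε2
  let L := L₀ ∪ closure Q
  have htail : ∫⁻ x in Lᶜ, φ x ∂μ ≤ ε / 2 :=
    (lintegral_mono_set (Set.compl_subset_compl.2 Set.subset_union_left)).trans htail₀
  have hboundary := ENNReal.Tendsto.mul_const (hK.tendsto L (hL₀.union hQ)) (Or.inr hfinite)
  rw [zero_mul] at hboundary
  filter_upwards [ENNReal.tendsto_nhds_zero.1 hboundary (ε / 2) hε2] with n hn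
  have hKn : μ (K n) ≠ ∞ := (hK.isCompact n).measure_ne_top
  calc (∫⁻ y in K n, ∫⁻ z in (K n)ᶜ * Q, φ (y⁻¹ * z) ∂μ ∂μ) / μ (K n)
      ≤ (μ (K n * L ∩ ((K n)ᶜ * L)) * ∫⁻ x, φ x ∂μ + μ (K n) * ∫⁻ x in Lᶜ, φ x ∂μ) / μ (K n) := by
        gcongr
        exact lintegral_setLIntegral_compl_mul_le hφ (hK.isCompact n).isClosed.measurableSet
          (subset_closure.trans Set.subset_union_right)
    _ = μ (K n * L ∩ ((K n)ᶜ * L)) / μ (K n) * ∫⁻ x, φ x ∂μ + ∫⁻ x in Lᶜ, φ x ∂μ := by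
        rw [ENNReal.add_div, ENNReal.mul_div_right_comm, mul_comm (μ (K n)) (∫⁻ x in Lᶜ, φ x ∂μ),
          ENNReal.mul_div_cancel_right (hK.nonnull n) hKn]
    _ ≤ ε / 2 + ε / 2 := add_le_add hn htail
    _ = ε := ENNReal.add_halves ε

end FolnerIntegrals

lemma IsRelCompactSymmUnitNhd.measure_interior_ne_zero {G : Type*} [Group G] [TopologicalSpace G]
    [MeasurableSpace G] {μ : Measure G} [μ.IsOpenPosMeasure] {Q : Set G}
    (hQ : IsRelCompactSymmUnitNhd Q) : μ (interior Q) ≠ 0 :=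
  isOpen_interior.measure_ne_zero μ ⟨1, mem_interior_iff_mem_nhds.2 hQ.1⟩

namespace ProjectiveRep

variable {G H : Type*} [Group G] [TopologicalSpace G] [IsTopologicalGroup G]
  [LocallyCompactSpace G] [SecondCountableTopology G] [MeasurableSpace G] [BorelSpace G]
  [NormedAddCommGroup H] [InnerProductSpace ℂ H] {π : ProjectiveRep G H} {μ : Measure G}
  {Λ K Q : Set G} {g : H} {A B d : ℝ}

section Counting

lemma measure_interior_mul_tsum_le [μ.IsMulLeftInvariant] (π : ProjectiveRep G H) (g : H)
    (hQ : Q⁻¹ = Q) (y : G) :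
    μ (interior Q) * ∑' l : (Λ \ K : Set G), ‖π.coeff g g (y⁻¹ * l)‖ₑ ^ 2 ≤
      relSeparation Q Λ * ∫⁻ z in Kᶜ * Q, localMax Q (π.coeff g g) (y⁻¹ * z) ^ 2 ∂μ := by
  have hmeas : Measurable fun z => localMax Q (π.coeff g g) (y⁻¹ * z) ^ 2 :=
    ((measurable_localMax (π.continuous_enorm_coeff g g) Q).comp
      (measurable_const_mul y⁻¹)).pow_const 2
  have hle (l : G) (u : G) (hu : u ∈ interior Q) :
      ‖π.coeff g g (y⁻¹ * l)‖ₑ ^ 2 ≤ localMax Q (π.coeff g g) (y⁻¹ * (l * u)) ^ 2 := by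
    have huQ : u⁻¹ ∈ Q := by rw [← hQ]; exact Set.inv_mem_inv.2 (interior_subset hu)
    have h := enorm_le_localMax (F := π.coeff g g) (y⁻¹ * (l * u)) huQ
    rw [← mul_assoc, mul_inv_cancel_right] at h
    rw [← mul_assoc]
    gcongr
  have hinv : (interior Q)⁻¹ ⊆ Q := by
    rw [← Set.inv_subset_inv, inv_inv, hQ]
    exact interior_subset
  calc μ (interior Q) * ∑' l : (Λ \ K : Set G), ‖π.coeff g g (y⁻¹ * l)‖ₑ ^ 2
      ≤ relSeparation (interior Q)⁻¹ (Λ \ K) *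
          ∫⁻ z in (Λ \ K) * interior Q, localMax Q (π.coeff g g) (y⁻¹ * z) ^ 2 ∂μ :=
        measure_mul_tsum_le (w := fun l => ‖π.coeff g g (y⁻¹ * l)‖ₑ ^ 2) isOpen_interior hmeas
          fun l _ => hle l
    _ ≤ relSeparation Q Λ * ∫⁻ z in Kᶜ * Q, localMax Q (π.coeff g g) (y⁻¹ * z) ^ 2 ∂μ := by
        gcongr
        · exact relSeparation_mono hinv Set.sdiff_subset
        · exact fun l hl => hl.2
        · exact interior_subset

lemma measure_interior_mul_lintegral_tsum_le_errorTerm [μ.IsMulLeftInvariant]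
    (π : ProjectiveRep G H) (g : H) (hQ : Q⁻¹ = Q) (hΛ : relSeparation Q Λ ≠ ⊤) :
    μ (interior Q) * ∫⁻ y in K, ∑' l : (Λ \ K : Set G), ‖π.coeff g g (y⁻¹ * l)‖ₑ ^ 2 ∂μ ≤
      relSeparation Q Λ * π.errorTerm μ Q g K := by
  rw [errorTerm, ← lintegral_const_mul' _ _ (ENat.toENNReal_ne_top.2 hΛ)]
  exact (lintegral_const_mul_le _ _).trans
    (lintegral_mono fun y => π.measure_interior_mul_tsum_le g hQ y)

lemma IsFrameWithBounds.finite_inter [Nontrivial H] (h : π.IsFrameWithBounds Λ g A B) {S : Set G}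
    (hS : IsCompact S) : (Λ ∩ S).Finite := by
  obtain ⟨N, hN⟩ := π.exists_relSeparation_le h.ne_zero B hS
  exact finite_inter_of_relSeparation_ne_top
    ((hN Λ h.isBesselWithBound).trans_lt (ENat.natCast_lt_top N)).ne

lemma IsFrameWithBounds.measure_mul_norm_sq_le_add_errorTerm [CompleteSpace H] [Nontrivial H]
    [μ.IsHaarMeasure] (hd : π.IsFormalDegree μ d) (hΛ : π.IsFrameWithBounds Λ g A B)
    (hQ : IsRelCompactSymmUnitNhd Q) {N : ℕ} (hN : relSeparation Q Λ ≤ N) (hK : IsCompact K) :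
    μ K * ENNReal.ofReal (‖g‖ ^ 2) ≤
      (Λ ∩ K).ncard * ENNReal.ofReal (d⁻¹ * ‖g‖ ^ 2) +
        ENNReal.ofReal A⁻¹ * (N * π.errorTerm μ Q g K / μ (interior Q)) := by
  have hQtop : μ (interior Q) ≠ ∞ :=
    measure_ne_top_of_subset (interior_subset.trans subset_closure) hQ.2.2.measure_ne_top
  refine (hΛ.measure_mul_norm_sq_le hd (hΛ.finite_inter hK)).trans ?_
  gcongr
  rw [ENNReal.le_div_iff_mul_le (Or.inl hQ.measure_interior_ne_zero) (Or.inl hQtop), mul_comm]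
  refine (π.measure_interior_mul_lintegral_tsum_le_errorTerm g hQ.2.1
    (hN.trans_lt (ENat.natCast_lt_top N)).ne).trans ?_
  gcongr
  exact_mod_cast ENat.toENNReal_le.2 hN

lemma IsFrameWithBounds.mul_measureReal_sub_le_ncard [CompleteSpace H] [Nontrivial H]
    [μ.IsHaarMeasure] (hd : π.IsFormalDegree μ d) (hΛ : π.IsFrameWithBounds Λ g A B)
    (hQ : IsRelCompactSymmUnitNhd Q) {N : ℕ} (hN : relSeparation Q Λ ≤ N) (hK : IsCompact K)
    (hI : π.errorTerm μ Q g K ≠ ∞) :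
    d * (μ.real K - N / (A * μ.real (interior Q) * ‖g‖ ^ 2) * (π.errorTerm μ Q g K).toReal) ≤
      (Λ ∩ K).ncard := by
  have hg : 0 < ‖g‖ := norm_pos_iff.2 hΛ.ne_zero
  have hA : 0 < A := hΛ.1
  have hdpos : 0 < d := hd.1
  have hQ0 : μ (interior Q) ≠ 0 := hQ.measure_interior_ne_zero
  have hcount : (Λ ∩ K).ncard * ENNReal.ofReal (d⁻¹ * ‖g‖ ^ 2) ≠ ∞ := by finiteness
  have herror : ENNReal.ofReal A⁻¹ * (N * π.errorTerm μ Q g K / μ (interior Q)) ≠ ∞ := by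
    finiteness
  have hreal := ENNReal.toReal_mono (ENNReal.add_ne_top.2 ⟨hcount, herror⟩)
    (hΛ.measure_mul_norm_sq_le_add_errorTerm hd hQ hN hK)
  rw [ENNReal.toReal_add hcount herror] at hreal
  simp only [ENNReal.toReal_mul, ENNReal.toReal_div, ENNReal.toReal_natCast,
    ENNReal.toReal_ofReal (sq_nonneg ‖g‖), ENNReal.toReal_ofReal (inv_pos.2 hA).le,
    ENNReal.toReal_ofReal (show 0 ≤ d⁻¹ * ‖g‖ ^ 2 by positivity), ← measureReal_def] at hreal
  set I := (π.errorTerm μ Q g K).toReal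
  have hdiv : μ.real K ≤ (Λ ∩ K).ncard * d⁻¹ + N / (A * μ.real (interior Q) * ‖g‖ ^ 2) * I := by
    refine le_of_mul_le_mul_right (hreal.trans_eq ?_) (pow_pos hg 2)
    field_simp
  calc d * (μ.real K - N / (A * μ.real (interior Q) * ‖g‖ ^ 2) * I)
      ≤ d * ((Λ ∩ K).ncard * d⁻¹) := by gcongr; linarith
    _ = (Λ ∩ K).ncard := by field_simp

end Counting

section ErrorTerm

lemma localizedVectors.lintegral_localMax_sq_ne_top [μ.IsMulRightInvariant]
    (hg : g ∈ π.localizedVectors μ) (hQ : IsCompact (closure Q)) :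
    ∫⁻ x, localMax Q (π.coeff g g) x ^ 2 ∂μ ≠ ∞ := by
  obtain ⟨Q₀, hQ₀, hfinite⟩ := hg
  exact (lintegral_localMax_sq_lt_top (π.continuous_enorm_coeff g g) hQ₀.1 hQ hfinite).ne

variable [μ.IsHaarMeasure] [μ.IsMulRightInvariant]

lemma errorTerm_ne_top (hg : g ∈ π.localizedVectors μ) (hQ : IsCompact (closure Q))
    (hK : μ K ≠ ∞) : π.errorTerm μ Q g K ≠ ∞ :=
  ne_top_of_le_ne_top
    (ENNReal.mul_ne_top hK (localizedVectors.lintegral_localMax_sq_ne_top hg hQ))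
    (lintegral_setLIntegral_inv_mul_le_measure_left_mul _ K (Kᶜ * Q))

lemma isLittleO_errorTerm [T2Space G] (hg : g ∈ π.localizedVectors μ) (hQ : IsCompact (closure Q))
    {K : ℕ → Set G} (hK : IsStrongFolner μ K) :
    (fun n => (π.errorTerm μ Q g (K n)).toReal) =o[atTop] fun n => μ.real (K n) := by
  have : μ.IsInvInvariant := isInvInvariant_of_isMulRightInvariant μ
  exact isLittleO_toReal_of_tendsto_div
    (hK.tendsto_lintegral_setLIntegral_div
      ((measurable_localMax (π.continuous_enorm_coeff g g) Q).pow_const 2)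
      (localizedVectors.lintegral_localMax_sq_ne_top hg hQ) hQ)
    hK.nonnull fun n => (hK.isCompact n).measure_ne_top

end ErrorTerm

lemma IsFormalDegree.exists_mul_measureReal_sub_le_iInf_ncard [CompleteSpace H] [Nontrivial H]
    [μ.IsHaarMeasure] [μ.IsMulRightInvariant] (hd : π.IsFormalDegree μ d)
    (hg : g ∈ π.localizedVectors μ) (hQ : IsRelCompactSymmUnitNhd Q) (A B : ℝ) :
    ∃ C : ℝ, 0 < C ∧ ∀ Λ, π.IsFrameWithBounds Λ g A B → ∀ K, IsCompact K →
      d * (μ.real K - C * (π.errorTerm μ Q g K).toReal) ≤ ⨅ x : G, ((Λ ∩ x • K).ncard : ℝ) := by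
  by_cases hg0 : g = 0
  · exact ⟨1, one_pos, fun Λ hΛ => absurd hg0 hΛ.ne_zero⟩
  obtain ⟨N, hN⟩ := π.exists_relSeparation_le hg0 B hQ.2.2
  refine ⟨max (N / (A * μ.real (interior Q) * ‖g‖ ^ 2)) 1, lt_max_of_lt_right one_pos,
    fun Λ hΛ K hK => le_ciInf fun x => ?_⟩
  have hxΛ : π.IsFrameWithBounds (x⁻¹ • Λ) g A B := hΛ.smul x⁻¹
  have hle := hxΛ.mul_measureReal_sub_le_ncard hd hQ
    ((relSeparation_mono subset_closure subset_rfl).trans (hN _ hxΛ.isBesselWithBound)) hK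
    (errorTerm_ne_top hg hQ.2.2 hK.measure_ne_top)
  have htranslate : x⁻¹ • Λ ∩ K = x⁻¹ • (Λ ∩ x • K) := by
    rw [Set.smul_set_inter, inv_smul_smul]
  rw [htranslate, Set.ncard_smul_set] at hle
  have hdpos : 0 < d := hd.1
  refine le_trans ?_ hle
  gcongr
  exact le_max_left _ _

end ProjectiveRep

theorem theorem3p3_general {G H : Type*}
    [Group G] [TopologicalSpace G] [IsTopologicalGroup G] [LocallyCompactSpace G] [T2Space G]
    [SecondCountableTopology G] [MeasurableSpace G] [BorelSpace G]
    (μ : Measure G) [μ.IsHaarMeasure] [μ.IsMulRightInvariant]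
    [NormedAddCommGroup H] [InnerProductSpace ℂ H] [CompleteSpace H]
    (π : ProjectiveRep G H) (hπ : π.IsDiscreteSeries μ) :
    (∃! d : ℝ, π.IsFormalDegree μ d) ∧
    ∀ d : ℝ, π.IsFormalDegree μ d →
    ∀ g ∈ π.localizedVectors μ, ∀ Q : Set G, IsRelCompactSymmUnitNhd Q → ∀ A B : ℝ,
      ∃ C : ℝ, 0 < C ∧
        ∀ Λ : Set G, π.IsFrameWithBounds Λ g A B →
        ∀ K : ℕ → Set G, IsStrongFolner μ K →
          (∀ n, π.errorTerm μ Q g (K n) ≠ ∞) ∧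
          (∀ (n : ℕ) (x : G), (Λ ∩ x • K n).Finite) ∧
          (∀ n, d * (μ.real (K n) - C * (π.errorTerm μ Q g (K n)).toReal) ≤
            ⨅ x : G, ((Λ ∩ x • K n).ncard : ℝ)) ∧
          (fun n => (π.errorTerm μ Q g (K n)).toReal) =o[atTop] (fun n => μ.real (K n)) := by
  have := hπ.nontrivial
  have := isInvInvariant_of_isMulRightInvariant μ
  obtain ⟨d₀, hd₀⟩ := hπ.exists_isFormalDegree
  refine ⟨⟨d₀, hd₀, fun d hd => hd.unique hd₀⟩, fun d hd g hg Q hQ A B => ?_⟩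
  obtain ⟨C, hC, hcount⟩ := hd.exists_mul_measureReal_sub_le_iInf_ncard hg hQ A B
  exact ⟨C, hC, fun Λ hΛ K hK =>
    ⟨fun n => ProjectiveRep.errorTerm_ne_top hg hQ.2.2 (hK.isCompact n).measure_ne_top,
      fun n x => hΛ.finite_inter ((hK.isCompact n).smul x),
      fun n => hcount Λ hΛ (K n) (hK.isCompact n),
      ProjectiveRep.isLittleO_errorTerm hg hQ.2.2 hK⟩⟩

theorem theorem3p3 {G H : Type*}
    [Group G] [TopologicalSpace G] [IsTopologicalGroup G] [LocallyCompactSpace G] [T2Space G]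
    [SecondCountableTopology G] [MeasurableSpace G] [BorelSpace G]
    (μ : Measure G) [μ.IsHaarMeasure] [μ.IsMulRightInvariant]
    [NormedAddCommGroup H] [InnerProductSpace ℂ H] [CompleteSpace H]
    [TopologicalSpace.SeparableSpace H]
    (π : ProjectiveRep G H) (hπ : π.IsDiscreteSeries μ) :
    (∃! d : ℝ, π.IsFormalDegree μ d) ∧
    ∀ d : ℝ, π.IsFormalDegree μ d →
    ∀ g ∈ π.localizedVectors μ, ∀ Q : Set G, IsRelCompactSymmUnitNhd Q → ∀ A B : ℝ,
      ∃ C : ℝ, 0 < C ∧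
        ∀ Λ : Set G, π.IsFrameWithBounds Λ g A B →
        ∀ K : ℕ → Set G, IsStrongFolnerExhaustion μ K →
          (∀ n, π.errorTerm μ Q g (K n) ≠ ∞) ∧
          (∀ (n : ℕ) (x : G), (Λ ∩ x • K n).Finite) ∧
          (∀ n, d * (μ.real (K n) - C * (π.errorTerm μ Q g (K n)).toReal) ≤
            ⨅ x : G, ((Λ ∩ x • K n).ncard : ℝ)) ∧
          (fun n => (π.errorTerm μ Q g (K n)).toReal) =o[atTop] (fun n => μ.real (K n)) := by
  obtain ⟨hdegree, hcount⟩ := theorem3p3_general μ π hπ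
  refine ⟨hdegree, fun d hd g hg Q hQ A B => ?_⟩
  obtain ⟨C, hC, h⟩ := hcount d hd g hg Q hQ A B
  exact ⟨C, hC, fun Λ hΛ K hK => h Λ hΛ K hK.toIsStrongFolner⟩
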